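/- Let $E$ be a locally compact separable metric space and $m$ a Radon measure on $E$ with full support. Let $(\mathscr E,\mathscr F)$ be a regular Dirichlet form on $L^2(E,m)$ (it may have killing), and write $\mathscr E_1(u,v)=\mathscr E(u,v)+(u,v)_m$. An increasing sequence $(F_k)$ of closed subsets of $E$ is an $\mathscr E$-nest if $\bigcup_k\{u\in\mathscr F: u=0\ m\text{-a.e. on }E\setminus F_k\}$ is $\mathscr E_1$-dense in $\mathscr F$; a set $N\subset E$ is $\mathscr E$-polar if $N\subset\bigcap_k(E\setminus F_k)$ for some $\mathscr E$-nest $(F_k)$; a function $f:E\to[-\infty,\infty]$ is $\mathscr E$-quasi-continuous if $f|_{F_k}$ is finite and continuous for every $k$, for some $\mathscr E$-nest $(F_k)$. Let $\mu$ be a nonzero finite Borel measure on $E$ that charges no $\mathscr E$-polar set. Put $|\mu|=\mu(E)$ and, each $u\in\mathscr F$ being represented by an $\mathscr E$-quasi-continuous version, $$\mathscr F^{\mathrm s}=\Big\{u\in\mathscr F:\int_{E\times E}(u(x)-u(y))^2\,\mu(dx)\mu(dy)<\infty\Big\},$$ $$\mathscr E^{\mathrm s}(u,v)=\mathscr E(u,v)+\frac1{2|\mu|}\int_{E\times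 E}(u(x)-u(y))(v(x)-v(y))\,\mu(dx)\mu(dy),\qquad u,v\in\mathscr F^{\mathrm s}.$$ Then $(\mathscr E^{\mathrm s},\mathscr F^{\mathrm s})$ is a regular Dirichlet form on $L^2(E,m)$. Moreover, an increasing sequence of closed subsets of $E$ (resp. a subset of $E$, a function $E\to[-\infty,\infty]$) is an $\mathscr E^{\mathrm s}$-nest (resp. $\mathscr E^{\mathrm s}$-polar, $\mathscr E^{\mathrm s}$-quasi-continuous) if and only if it is an $\mathscr E$-nest (resp. $\mathscr E$-polar, $\mathscr E$-quasi-continuous), where the $\mathscr E^{\mathrm s}$-notions are defined in the same way with $(\mathscr E^{\mathrm s},\mathscr F^{\mathrm s})$ in place of $(\mathscr E,\mathscr F)$. -/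

import Mathlib

open MeasureTheory Filter Topology
open scoped ENNReal

namespace SnappingOut

/-- A raw pair `(ℰ, 𝓕)`: a set `dom` of elements of `L²(E, m)` and a real function `form` of two
variables. Only the values of `form` on `dom × dom` are ever used. All the laws of a Dirichlet form
are in the predicates `IsDirichletForm` and `IsRegular` below. -/
structure FormPair {E : Type*} [MeasurableSpace E] (m : Measure E) where
  dom : Set (Lp ℝ 2 m)
  form : Lp ℝ 2 m → Lp ℝ 2 m → ℝ

namespace FormPair

variable {E : Type*} [MeasurableSpace E] {m : Measure E}

/-- `ℰ₁(u, v) = ℰ(u, v) + (u, v)_m`. -/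
noncomputable def form₁ (𝓔 : FormPair m) (u v : Lp ℝ 2 m) : ℝ :=
  𝓔.form u v + ∫ x, u x * v x ∂m

/-- `(ℰ, 𝓕)` is a (symmetric) Dirichlet form on `L²(E, m)`: a densely defined, nonnegative
definite, symmetric bilinear form, which is closed and on which the unit contraction operates. -/
structure IsDirichletForm (𝓔 : FormPair m) : Prop where
  zero_mem : (0 : Lp ℝ 2 m) ∈ 𝓔.dom
  add_mem : ∀ u ∈ 𝓔.dom, ∀ v ∈ 𝓔.dom, u + v ∈ 𝓔.dom
  smul_mem : ∀ c : ℝ, ∀ u ∈ 𝓔.dom, c • u ∈ 𝓔.dom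
  dense : Dense 𝓔.dom
  add_left : ∀ u ∈ 𝓔.dom, ∀ v ∈ 𝓔.dom, ∀ w ∈ 𝓔.dom,
    𝓔.form (u + v) w = 𝓔.form u w + 𝓔.form v w
  smul_left : ∀ c : ℝ, ∀ u ∈ 𝓔.dom, ∀ v ∈ 𝓔.dom, 𝓔.form (c • u) v = c * 𝓔.form u v
  symm : ∀ u ∈ 𝓔.dom, ∀ v ∈ 𝓔.dom, 𝓔.form u v = 𝓔.form v u
  nonneg : ∀ u ∈ 𝓔.dom, 0 ≤ 𝓔.form u u
  /-- `𝓕` is complete for the inner product `ℰ₁`. -/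
  complete : ∀ u : ℕ → Lp ℝ 2 m, (∀ n, u n ∈ 𝓔.dom) →
    (∀ ε > 0, ∃ N, ∀ i ≥ N, ∀ j ≥ N, 𝓔.form₁ (u i - u j) (u i - u j) < ε) →
    ∃ v ∈ 𝓔.dom, Tendsto (fun n => 𝓔.form₁ (u n - v) (u n - v)) atTop (𝓝 0)
  /-- For `u ∈ 𝓕` the function `v = (0 ∨ u) ∧ 1` is in `𝓕` and `ℰ(v, v) ≤ ℰ(u, u)`. -/
  markov : ∀ u ∈ 𝓔.dom, ∃ v ∈ 𝓔.dom,
    (∀ᵐ x ∂m, v x = min (max 0 (u x)) 1) ∧ 𝓔.form v v ≤ 𝓔.form u u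

variable [TopologicalSpace E]

/-- `𝓕 ∩ C_c(E)` is dense in `𝓕` for `ℰ₁`, and dense in `C_c(E)` for the uniform norm. -/
structure IsRegular (𝓔 : FormPair m) : Prop where
  dense_dom : ∀ u ∈ 𝓔.dom, ∀ ε > 0, ∃ v ∈ 𝓔.dom,
    (∃ g : E → ℝ, Continuous g ∧ HasCompactSupport g ∧ v =ᵐ[m] g) ∧ 𝓔.form₁ (u - v) (u - v) < ε
  dense_Cc : ∀ f : E → ℝ, Continuous f → HasCompactSupport f → ∀ ε > 0, ∃ g : E → ℝ,
    Continuous g ∧ HasCompactSupport g ∧ (∃ v ∈ 𝓔.dom, v =ᵐ[m] g) ∧ ∀ x, |f x - g x| < ε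

/-- An increasing sequence `(F_k)` of closed sets is an `ℰ`-nest if `⋃ₖ {v ∈ 𝓕 : v = 0 m-a.e. on
`E \ F_k`}` is dense in `𝓕` for `ℰ₁`. -/
structure IsNest (𝓔 : FormPair m) (F : ℕ → Set E) : Prop where
  mono : Monotone F
  closed : ∀ k, IsClosed (F k)
  dense : ∀ u ∈ 𝓔.dom, ∀ ε > 0, ∃ k, ∃ v ∈ 𝓔.dom,
    (∀ᵐ x ∂m, x ∉ F k → v x = 0) ∧ 𝓔.form₁ (u - v) (u - v) < ε

/-- `N` is `ℰ`-polar if it is contained in `⋂ₖ (E \ F_k)` for some `ℰ`-nest `(F_k)`. -/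
def IsPolar (𝓔 : FormPair m) (N : Set E) : Prop :=
  ∃ F : ℕ → Set E, 𝓔.IsNest F ∧ N ⊆ ⋂ k, (F k)ᶜ

/-- An extended real function `f` is `ℰ`-quasi-continuous if, for some `ℰ`-nest `(F_k)`, its
restriction to each `F_k` is finite and continuous. -/
def IsQuasiContinuous (𝓔 : FormPair m) (f : E → EReal) : Prop :=
  ∃ F : ℕ → Set E, 𝓔.IsNest F ∧ ∀ k, ContinuousOn f (F k) ∧ ∀ x ∈ F k, f x ≠ ⊥ ∧ f x ≠ ⊤

/-- `f` is an everywhere defined, real-valued `ℰ`-quasi-continuous `m`-version of `u`. -/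
def IsQCVersion (𝓔 : FormPair m) (u : Lp ℝ 2 m) (f : E → ℝ) : Prop :=
  𝓔.IsQuasiContinuous (fun x => (f x : EReal)) ∧ u =ᵐ[m] f

open Classical in
/-- A chosen `ℰ`-quasi-continuous version of `u`. (When `(ℰ, 𝓕)` is a regular Dirichlet form, every
`u ∈ 𝓕` has one, and any two of them agree outside an `ℰ`-polar set.) -/
noncomputable def qcVersion (𝓔 : FormPair m) (u : Lp ℝ 2 m) : E → ℝ :=
  if h : ∃ f : E → ℝ, 𝓔.IsQCVersion u f then h.choose else u

/-- The form `(ℰˢ, 𝓕ˢ)`, in which functions are represented by their `ℰ`-quasi-continuous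
versions: `𝓕ˢ = {u ∈ 𝓕 : ∫∫ (u(x) - u(y))² μ(dx) μ(dy) < ∞}` and
`ℰˢ(u, v) = ℰ(u, v) + (2 μ(E))⁻¹ ∫∫ (u(x) - u(y)) (v(x) - v(y)) μ(dx) μ(dy)`. -/
noncomputable def snap (𝓔 : FormPair m) (μ : Measure E) : FormPair m where
  dom := {u | u ∈ 𝓔.dom ∧
    ∫⁻ p, ENNReal.ofReal ((𝓔.qcVersion u p.1 - 𝓔.qcVersion u p.2) ^ 2) ∂(μ.prod μ) < ∞}
  form u v := 𝓔.form u v + 1 / (2 * μ.real Set.univ) *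
    ∫ p, (𝓔.qcVersion u p.1 - 𝓔.qcVersion u p.2) * (𝓔.qcVersion v p.1 - 𝓔.qcVersion v p.2)
      ∂(μ.prod μ)

end FormPair

end SnappingOut

set_option linter.unusedSectionVars false

/-! Since `μ` is finite, truncation tames the jump term: for every `u ∈ 𝓕` the function `(0 ∨ u) ∧
n` has jump energy at most `(2n)² μ(E)²`, whatever `u` is (`jump_cut_le`). Hence truncations of
elements of `𝓕` lie in `𝓕ˢ`, and truncating an `ℰ₁`-bounded sequence makes it `ℰˢ₁`-bounded.

This is combined with a weak compactness principle (`mem_cl_of_tendsto`): if a sequence in a closed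
subspace of the domain is bounded in energy and converges in `L²`, its limit is in the subspace. So
a subspace that is `ℰ₁`-dense in `𝓕` and stable under truncation has `ℰˢ₁`-dense trace on `𝓕ˢ`
(`mem_cl_snap`). Applied to `𝓕 ∩ C_c(E)` this gives regularity; applied to the functions vanishing
off some `F k` it shows that `ℰ`-nests are `ℰˢ`-nests. The converse uses `ℰ₁ ≤ ℰˢ₁` and the density
of truncations. Polarity and quasi-continuity depend on the form only through its nests.

Closedness is Fatou's lemma for the jump term, along a subsequence whose quasi-continuous versions
converge `μ`-a.e. That the form is well defined on `m`-classes rests on two facts proved from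
scratch: quasi-continuous versions exist (`exists_qc_version`), and `m`-a.e. inequalities between
quasi-continuous functions hold off a polar set, hence `μ`-a.e. (`QC.isPolar_not_le`, `QC.ae_le`).
-/

namespace SnappingOut.FormPair

/-! ### Weak compactness in Hilbert space. -/

section Hilbert

/-- A bounded sequence in a closed subspace of a Hilbert space whose image under a continuous linear
map converges has a weak cluster point, which is a preimage of the limit. -/
theorem exists_mem_of_tendsto_map {H L : Type*} [NormedAddCommGroup H] [InnerProductSpace ℝ H]
    [CompleteSpace H] [NormedAddCommGroup L] [InnerProductSpace ℝ L] [CompleteSpace L]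
    (ι : H →L[ℝ] L) (V : Submodule ℝ H) (hV : IsClosed (V : Set H)) (w : ℕ → H)
    (hw : ∀ k, w k ∈ V) {C : ℝ} (hC : ∀ k, ‖w k‖ ≤ C) {l : L}
    (hl : Tendsto (fun k => ι (w k)) atTop (𝓝 l)) : ∃ u ∈ V, ‖u‖ ≤ C ∧ ι u = l := by
  let T : H → WeakDual ℝ H := fun x => StrongDual.toWeakDual (InnerProductSpace.toDual ℝ H x)
  have hcomp := WeakDual.isCompact_closedBall (𝕜 := ℝ) (0 : StrongDual ℝ H) C
  -- An ultrafilter limit takes the place of a weakly convergent subsequence, so Banach–Alaoglu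
  -- suffices and `H` need not be separable.
  let 𝒰 : Ultrafilter ℕ := Ultrafilter.of atTop
  have h𝒰 : (𝒰 : Filter ℕ) ≤ atTop := Ultrafilter.of_le atTop
  obtain ⟨φ, hφ, hlim⟩ := hcomp.ultrafilter_le_nhds (𝒰.map (fun k => T (w k))) (by
    rw [Ultrafilter.coe_map, le_principal_iff, mem_map]
    refine Filter.univ_mem' (fun k => ?_)
    simp [T, hC k])
  let u : H := (InnerProductSpace.toDual ℝ H).symm (WeakDual.toStrongDual φ)
  have hu : ∀ g, Tendsto (fun k => inner ℝ (w k) g) 𝒰 (𝓝 (inner ℝ u g)) := by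
    intro g
    have h1 : Tendsto (fun k => T (w k)) 𝒰 (𝓝 φ) := hlim
    have h2 := (WeakDual.eval_continuous (𝕜 := ℝ) g).continuousAt.tendsto.comp h1
    have h3 : φ g = inner ℝ u g := by simp [u]
    rw [← h3]
    refine h2.congr (fun k => ?_)
    simp [T]
  refine ⟨u, ?_, ?_, ?_⟩
  · have : V = Vᗮᗮ := by
      have : CompleteSpace V := hV.completeSpace_coe
      simp
    rw [this, Submodule.mem_orthogonal]
    intro g hg
    have h0 : ∀ k, inner ℝ (w k) g = 0 := fun k => (Submodule.mem_orthogonal _ _).1 hg _ (hw k)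
    have := hu g
    simp only [h0] at this
    rw [real_inner_comm]
    exact tendsto_nhds_unique this tendsto_const_nhds
  · have : ‖WeakDual.toStrongDual φ‖ ≤ C := by simpa using hφ
    simpa [u] using this
  · refine ext_inner_right ℝ (fun f => ?_)
    have h1 := hu (ι.adjoint f)
    simp only [ContinuousLinearMap.adjoint_inner_right] at h1
    exact tendsto_nhds_unique h1 ((hl.mono_left h𝒰).inner tendsto_const_nhds)

end Hilbert

variable {E : Type*} [MeasurableSpace E] {m : Measure E} {𝓔 : FormPair m}

theorem form₁_eq (𝓔 : FormPair m) (u v : Lp ℝ 2 m) : 𝓔.form₁ u v = 𝓔.form u v + inner ℝ u v := by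
  simp only [form₁, L2.inner_def]
  congr 1
  refine integral_congr_ae (Eventually.of_forall fun x => ?_)
  simp [mul_comm]

/-! ### The domain as a Hilbert space for `ℰ₁`, and closures of subspaces in it. -/

namespace IsDirichletForm

/-- The domain of a Dirichlet form, as a subspace of `L²`. -/
def toSubmodule (hD : 𝓔.IsDirichletForm) : Submodule ℝ (Lp ℝ 2 m) where
  carrier := 𝓔.dom
  zero_mem' := hD.zero_mem
  add_mem' := fun ha hb => hD.add_mem _ ha _ hb
  smul_mem' := fun c _ hx => hD.smul_mem c _ hx

theorem sub_mem (hD : 𝓔.IsDirichletForm) {u v : Lp ℝ 2 m} (hu : u ∈ 𝓔.dom) (hv : v ∈ 𝓔.dom) :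
    u - v ∈ 𝓔.dom := hD.toSubmodule.sub_mem hu hv

theorem neg_mem (hD : 𝓔.IsDirichletForm) {u : Lp ℝ 2 m} (hu : u ∈ 𝓔.dom) :
    -u ∈ 𝓔.dom := hD.toSubmodule.neg_mem hu

/-- The domain of a Dirichlet form, as a Hilbert space for `ℰ₁`. -/
def Hilb (hD : 𝓔.IsDirichletForm) : Type _ := ↥hD.toSubmodule

/-- Only the algebraic structure is transported from the submodule: its norm is that of `L²`,
whereas `Hilb` is to carry the norm of `ℰ₁`. -/
noncomputable instance (hD : 𝓔.IsDirichletForm) : AddCommGroup hD.Hilb :=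
  inferInstanceAs (AddCommGroup hD.toSubmodule)

noncomputable instance (hD : 𝓔.IsDirichletForm) : Module ℝ hD.Hilb :=
  inferInstanceAs (Module ℝ hD.toSubmodule)

/-- The linear embedding of the domain into `L²`. -/
def incl (hD : 𝓔.IsDirichletForm) : hD.Hilb →ₗ[ℝ] Lp ℝ 2 m := hD.toSubmodule.subtype

theorem incl_mem (hD : 𝓔.IsDirichletForm) (u : hD.Hilb) : hD.incl u ∈ 𝓔.dom := u.2

theorem incl_injective (hD : 𝓔.IsDirichletForm) : Function.Injective hD.incl :=
  Subtype.val_injective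

theorem exists_incl (hD : 𝓔.IsDirichletForm) {u : Lp ℝ 2 m} (hu : u ∈ 𝓔.dom) :
    ∃ x : hD.Hilb, hD.incl x = u := ⟨⟨u, hu⟩, rfl⟩

/-- The inner product `ℰ₁` on the domain. -/
@[reducible] noncomputable def core (hD : 𝓔.IsDirichletForm) : InnerProductSpace.Core ℝ hD.Hilb where
  inner u v := 𝓔.form₁ (hD.incl u) (hD.incl v)
  conj_inner_symm u v := by
    simp only [form₁_eq, conj_trivial]
    rw [hD.symm _ (hD.incl_mem _) _ (hD.incl_mem _), real_inner_comm]
  re_inner_nonneg u := by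
    simp only [form₁_eq]
    exact add_nonneg (hD.nonneg _ (hD.incl_mem _)) real_inner_self_nonneg
  add_left u v w := by
    simp only [form₁_eq, map_add, inner_add_left]
    rw [hD.add_left _ (hD.incl_mem _) _ (hD.incl_mem _) _ (hD.incl_mem _)]
    ring
  smul_left u v r := by
    simp only [form₁_eq, map_smul, real_inner_smul_left, conj_trivial]
    rw [hD.smul_left _ _ (hD.incl_mem _) _ (hD.incl_mem _)]
    ring
  definite u h := by
    simp only [form₁_eq] at h
    have h1 := hD.nonneg _ (hD.incl_mem u)
    have h2 := real_inner_self_nonneg (x := hD.incl u)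
    have h3 : inner ℝ (hD.incl u) (hD.incl u) = 0 := by linarith
    rw [inner_self_eq_zero] at h3
    exact hD.incl_injective (by rw [h3, map_zero])

noncomputable instance (hD : 𝓔.IsDirichletForm) : NormedAddCommGroup hD.Hilb :=
  @InnerProductSpace.Core.toNormedAddCommGroup ℝ _ _ _ _ hD.core

noncomputable instance (hD : 𝓔.IsDirichletForm) : InnerProductSpace ℝ hD.Hilb :=
  InnerProductSpace.ofCore hD.core.toCore

theorem norm_sq (hD : 𝓔.IsDirichletForm) (u : hD.Hilb) :
    ‖u‖ ^ 2 = 𝓔.form₁ (hD.incl u) (hD.incl u) :=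
  (real_inner_self_eq_norm_sq u).symm

instance (hD : 𝓔.IsDirichletForm) : CompleteSpace hD.Hilb := by
  refine Metric.complete_of_cauchySeq_tendsto (fun u hu => ?_)
  obtain ⟨v, hv, hlim⟩ := hD.complete (fun n => hD.incl (u n)) (fun n => hD.incl_mem _) (by
    intro ε hε
    obtain ⟨N, hN⟩ := Metric.cauchySeq_iff.1 hu (√ε) (by positivity)
    refine ⟨N, fun i hi j hj => ?_⟩
    rw [← map_sub, ← norm_sq, ← dist_eq_norm]
    exact (Real.lt_sqrt dist_nonneg).1 (hN i hi j hj))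
  obtain ⟨v, rfl⟩ := hD.exists_incl hv
  refine ⟨v, ?_⟩
  rw [tendsto_iff_norm_sub_tendsto_zero]
  simp only [← map_sub, ← norm_sq] at hlim
  have := hlim.sqrt
  simpa using this

/-- The domain embeds continuously into `L²`. -/
noncomputable def inclL (hD : 𝓔.IsDirichletForm) : hD.Hilb →L[ℝ] Lp ℝ 2 m :=
  hD.incl.mkContinuous 1 (fun u => by
    rw [one_mul]
    refine le_of_sq_le_sq ?_ (norm_nonneg _)
    rw [norm_sq, form₁_eq, ← real_inner_self_eq_norm_sq]
    linarith [hD.nonneg _ (hD.incl_mem u)])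

theorem inclL_apply (hD : 𝓔.IsDirichletForm) (u : hD.Hilb) : hD.inclL u = hD.incl u := rfl

/-- The `ℰ₁`-closure in the domain of (the trace of) a subspace of `L²`. -/
noncomputable def cl (hD : 𝓔.IsDirichletForm) (V : Submodule ℝ (Lp ℝ 2 m)) :
    Submodule ℝ (Lp ℝ 2 m) :=
  ((V.comap hD.incl).topologicalClosure).map hD.incl

theorem mem_cl (hD : 𝓔.IsDirichletForm) {V : Submodule ℝ (Lp ℝ 2 m)} {u : Lp ℝ 2 m} :
    u ∈ hD.cl V ↔ u ∈ 𝓔.dom ∧ ∀ ε > 0, ∃ v ∈ V, v ∈ 𝓔.dom ∧ 𝓔.form₁ (u - v) (u - v) < ε := by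
  constructor
  · rintro ⟨x, hx, rfl⟩
    refine ⟨hD.incl_mem x, fun ε hε => ?_⟩
    obtain ⟨y, hy, hxy⟩ := Metric.mem_closure_iff.1 hx (√ε) (by positivity)
    refine ⟨hD.incl y, hy, hD.incl_mem y, ?_⟩
    rw [← map_sub, ← norm_sq, ← dist_eq_norm]
    exact (Real.lt_sqrt dist_nonneg).1 hxy
  · rintro ⟨hu, h⟩
    obtain ⟨x, rfl⟩ := hD.exists_incl hu
    refine ⟨x, Metric.mem_closure_iff.2 fun ε hε => ?_, rfl⟩
    obtain ⟨v, hv, hv', hlt⟩ := h (ε ^ 2) (by positivity)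
    obtain ⟨y, rfl⟩ := hD.exists_incl hv'
    refine ⟨y, hv, ?_⟩
    rw [← map_sub, ← norm_sq, ← dist_eq_norm] at hlt
    exact lt_of_pow_lt_pow_left₀ 2 hε.le hlt

/-- Weak closedness of `ℰ₁`-closed subspaces and lower semicontinuity of `ℰ₁` along
`ℰ₁`-bounded sequences converging in `L²`. -/
theorem mem_cl_of_tendsto (hD : 𝓔.IsDirichletForm) {V : Submodule ℝ (Lp ℝ 2 m)}
    {w : ℕ → Lp ℝ 2 m} (hw : ∀ k, w k ∈ hD.cl V) {C : ℝ} (hC : ∀ k, 𝓔.form₁ (w k) (w k) ≤ C)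
    {u : Lp ℝ 2 m} (hu : Tendsto w atTop (𝓝 u)) : u ∈ hD.cl V ∧ 𝓔.form₁ u u ≤ C := by
  choose x hx hxw using hw
  obtain rfl : (fun k => hD.incl (x k)) = w := funext hxw
  have hC0 : 0 ≤ C := by
    refine le_trans ?_ (hC 0)
    rw [← norm_sq]; positivity
  obtain ⟨y, hy, hyC, rfl⟩ := exists_mem_of_tendsto_map hD.inclL _
    (Submodule.isClosed_topologicalClosure _) x hx (C := √C)
    (fun k => Real.le_sqrt_of_sq_le (by rw [norm_sq]; exact hC k)) hu
  refine ⟨⟨y, hy, rfl⟩, ?_⟩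
  rw [inclL_apply, ← norm_sq]
  exact (Real.le_sqrt (norm_nonneg _) hC0).1 hyC

theorem mem_dom_of_tendsto (hD : 𝓔.IsDirichletForm)
    {w : ℕ → Lp ℝ 2 m} (hw : ∀ k, w k ∈ 𝓔.dom) {C : ℝ} (hC : ∀ k, 𝓔.form₁ (w k) (w k) ≤ C)
    {u : Lp ℝ 2 m} (hu : Tendsto w atTop (𝓝 u)) : u ∈ 𝓔.dom ∧ 𝓔.form₁ u u ≤ C := by
  have hsub : ∀ k, w k ∈ hD.cl ⊤ := fun k => by
    obtain ⟨x, hx⟩ := hD.exists_incl (hw k)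
    exact ⟨x, subset_closure (by simp), hx⟩
  obtain ⟨h1, h2⟩ := hD.mem_cl_of_tendsto hsub hC hu
  exact ⟨(hD.mem_cl.1 h1).1, h2⟩

theorem form₁_nonneg (hD : 𝓔.IsDirichletForm) {u : Lp ℝ 2 m} (hu : u ∈ 𝓔.dom) :
    0 ≤ 𝓔.form₁ u u := by
  obtain ⟨x, rfl⟩ := hD.exists_incl hu
  rw [← norm_sq]; positivity

theorem form₁_sub_le (hD : 𝓔.IsDirichletForm) {u v : Lp ℝ 2 m} (hu : u ∈ 𝓔.dom)
    (hv : v ∈ 𝓔.dom) : 𝓔.form₁ (u - v) (u - v) ≤ 2 * 𝓔.form₁ u u + 2 * 𝓔.form₁ v v := by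
  obtain ⟨x, rfl⟩ := hD.exists_incl hu
  obtain ⟨y, rfl⟩ := hD.exists_incl hv
  rw [← map_sub]
  simp only [← norm_sq]
  have := parallelogram_law_with_norm ℝ x y
  nlinarith [sq_nonneg ‖x + y‖]

theorem form₁_smul (hD : 𝓔.IsDirichletForm) (c : ℝ) {u : Lp ℝ 2 m} (hu : u ∈ 𝓔.dom) :
    𝓔.form₁ (c • u) (c • u) = c ^ 2 * 𝓔.form₁ u u := by
  obtain ⟨x, rfl⟩ := hD.exists_incl hu
  rw [← map_smul]
  simp only [← norm_sq, norm_smul, mul_pow, Real.norm_eq_abs, sq_abs]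

theorem norm_sq_le_form₁ (hD : 𝓔.IsDirichletForm) {u : Lp ℝ 2 m} (hu : u ∈ 𝓔.dom) :
    ‖u‖ ^ 2 ≤ 𝓔.form₁ u u := by
  rw [form₁_eq, ← real_inner_self_eq_norm_sq]
  linarith [hD.nonneg u hu]

end IsDirichletForm

/-! ### Truncations and positive parts. -/

/-- The contraction of the real line onto `[0, n]`. -/
noncomputable def cutFun (n : ℕ) (x : ℝ) : ℝ := min (max 0 x) n

theorem lipschitzWith_cutFun (n : ℕ) : LipschitzWith 1 (cutFun n) :=
  (LipschitzWith.id.const_max 0).min_const _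

theorem cutFun_zero_right (n : ℕ) : cutFun n 0 = 0 := by simp [cutFun]

theorem cutFun_nonneg (n : ℕ) (x : ℝ) : 0 ≤ cutFun n x := by simp [cutFun]

theorem cutFun_le (n : ℕ) (x : ℝ) : cutFun n x ≤ n := min_le_right _ _

theorem sq_cutFun_sub_le (n : ℕ) (x y : ℝ) : (cutFun n x - cutFun n y) ^ 2 ≤ (x - y) ^ 2 := by
  have := (lipschitzWith_cutFun n).dist_le_mul x y
  rw [Real.dist_eq, Real.dist_eq, NNReal.coe_one, one_mul] at this
  exact sq_le_sq.2 this

/-- The truncation `(0 ∨ u) ∧ n` in `L²`. -/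
noncomputable def cut (n : ℕ) (u : Lp ℝ 2 m) : Lp ℝ 2 m :=
  (lipschitzWith_cutFun n).compLp (cutFun_zero_right n) u

theorem coeFn_cut (n : ℕ) (u : Lp ℝ 2 m) : ∀ᵐ x ∂m, cut n u x = cutFun n (u x) :=
  (lipschitzWith_cutFun n).coeFn_compLp (cutFun_zero_right n) u

theorem continuous_cut (n : ℕ) : Continuous (cut n : Lp ℝ 2 m → Lp ℝ 2 m) :=
  (lipschitzWith_cutFun n).continuous_compLp (cutFun_zero_right n)

theorem norm_cut_le (n : ℕ) (u : Lp ℝ 2 m) : ‖cut n u‖ ≤ ‖u‖ := by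
  simpa [cut] using (lipschitzWith_cutFun n).norm_compLp_le (cutFun_zero_right n) u

theorem tendsto_cut (u : Lp ℝ 2 m) :
    Tendsto (fun n => cut n u) atTop (𝓝 (Lp.posPart u)) := by
  rw [tendsto_iff_norm_sub_tendsto_zero]
  have hsq : Tendsto (fun n => ‖cut n u - Lp.posPart u‖ ^ 2) atTop (𝓝 0) := by
    have h : ∀ n, ‖cut n u - Lp.posPart u‖ ^ 2 = ∫ x, (cutFun n (u x) - max (u x) 0) ^ 2 ∂m := by
      intro n
      rw [← real_inner_self_eq_norm_sq, L2.inner_def]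
      refine integral_congr_ae ?_
      filter_upwards [coeFn_cut n u, Lp.coeFn_posPart u, Lp.coeFn_sub (cut n u) (Lp.posPart u)]
        with x h1 h2 h3
      rw [h3, Pi.sub_apply, h1, h2, real_inner_self_eq_norm_sq, Real.norm_eq_abs, sq_abs]
    have h0 : Tendsto (fun n : ℕ => ∫ x, (cutFun n (u x) - max (u x) 0) ^ 2 ∂m) atTop
        (𝓝 (∫ _, (0 : ℝ) ∂m)) := ?_
    · simpa [h] using h0
    refine tendsto_integral_of_dominated_convergence (fun x => u x ^ 2) (fun n => ?_)
      (Lp.memLp u).integrable_sq (fun n => ?_) ?_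
    · have hu := (Lp.aestronglyMeasurable u)
      exact ((((lipschitzWith_cutFun n).continuous.comp_aestronglyMeasurable hu).sub
        ((continuous_id.max continuous_const).comp_aestronglyMeasurable hu)).pow 2)
    · refine Eventually.of_forall fun x => ?_
      rw [Real.norm_eq_abs, abs_of_nonneg (sq_nonneg _)]
      refine sq_le_sq.2 ?_
      rcases le_total (u x) 0 with h | h
      · simp [cutFun, h]
      · rw [cutFun, max_eq_right h, max_eq_left h]
        rcases le_total (u x) n with h' | h'
        · simp [h']
        · rw [min_eq_right h', abs_of_nonpos (by linarith), abs_of_nonneg h]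
          have : (0 : ℝ) ≤ n := by positivity
          linarith
    · refine Eventually.of_forall fun x => ?_
      refine tendsto_const_nhds.congr' ?_
      obtain ⟨N, hN⟩ := exists_nat_ge (u x)
      filter_upwards [eventually_ge_atTop N] with n hn
      have : u x ≤ n := hN.trans (by exact_mod_cast hn)
      rw [cutFun, min_eq_left (max_le (by positivity) this), max_comm]
      simp
  simpa using hsq.sqrt

theorem posPart_sub_posPart_neg (u : Lp ℝ 2 m) : Lp.posPart u - Lp.posPart (-u) = u := by
  refine Lp.ext ?_
  filter_upwards [Lp.coeFn_posPart u, Lp.coeFn_posPart (-u), Lp.coeFn_neg u,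
    Lp.coeFn_sub (Lp.posPart u) (Lp.posPart (-u))] with x h1 h2 h3 h4
  rw [h4, Pi.sub_apply, h1, h2, h3, Pi.neg_apply]
  rcases le_total (u x) 0 with h | h
  · simp [h]
  · simp [h]

namespace IsDirichletForm

/-- The Markov property is given at height `1` only; applying it to `u / n` and scaling back gives
height `n`. The division is why `n = 0` is treated apart. -/
theorem cut_mem (hD : 𝓔.IsDirichletForm) (n : ℕ) {u : Lp ℝ 2 m} (hu : u ∈ 𝓔.dom) :
    cut n u ∈ 𝓔.dom ∧ 𝓔.form₁ (cut n u) (cut n u) ≤ 𝓔.form₁ u u := by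
  rcases Nat.eq_zero_or_pos n with rfl | hn
  · have h0 : cut 0 u = 0 := by
      refine Lp.ext ?_
      filter_upwards [coeFn_cut 0 u, Lp.coeFn_zero ℝ 2 m] with x h1 h2
      rw [h1, h2]
      simp [cutFun]
    rw [h0]
    refine ⟨hD.zero_mem, ?_⟩
    have : 𝓔.form₁ 0 0 = 0 := by
      have := hD.form₁_smul 0 hD.zero_mem
      simpa using this
    rw [this]
    exact hD.form₁_nonneg hu
  · have hn' : (0 : ℝ) < n := by exact_mod_cast hn
    have hu' := hD.smul_mem (n : ℝ)⁻¹ u hu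
    obtain ⟨v, hv, hvu, hle⟩ := hD.markov _ hu'
    have hcut : cut n u = (n : ℝ) • v := by
      refine Lp.ext ?_
      filter_upwards [coeFn_cut n u, hvu, Lp.coeFn_smul (n : ℝ) v, Lp.coeFn_smul (n : ℝ)⁻¹ u]
        with x h1 h2 h3 h4
      rw [h1, h3, Pi.smul_apply, h2, h4, Pi.smul_apply, cutFun, smul_eq_mul, smul_eq_mul,
        mul_min_of_nonneg _ _ hn'.le, mul_max_of_nonneg _ _ hn'.le, mul_inv_cancel_left₀ hn'.ne']
      simp
    have hmem : cut n u ∈ 𝓔.dom := hcut ▸ hD.smul_mem _ _ hv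
    refine ⟨hmem, ?_⟩
    have hform : 𝓔.form (cut n u) (cut n u) ≤ 𝓔.form u u := by
      rw [hD.smul_left _ _ hu _ hu', hD.symm _ hu _ hu', hD.smul_left _ _ hu _ hu] at hle
      rw [hcut, hD.smul_left _ _ hv _ (hcut ▸ hmem), hD.symm _ hv _ (hcut ▸ hmem),
        hD.smul_left _ _ hv _ hv]
      calc (n : ℝ) * (n * 𝓔.form v v) ≤ n * (n * ((n : ℝ)⁻¹ * ((n : ℝ)⁻¹ * 𝓔.form u u))) := by
            gcongr
        _ = 𝓔.form u u := by field_simp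
    rw [form₁_eq, form₁_eq, real_inner_self_eq_norm_sq, real_inner_self_eq_norm_sq]
    have := norm_cut_le n u
    gcongr

/-- The truncations of `u` converge to `u⁺` in `L²` with energy bounded by that of `u`, so weak
compactness applies. -/
theorem posPart_mem (hD : 𝓔.IsDirichletForm) {u : Lp ℝ 2 m} (hu : u ∈ 𝓔.dom) :
    Lp.posPart u ∈ 𝓔.dom ∧ 𝓔.form₁ (Lp.posPart u) (Lp.posPart u) ≤ 𝓔.form₁ u u :=
  hD.mem_dom_of_tendsto (fun n => (hD.cut_mem n hu).1) (fun n => (hD.cut_mem n hu).2)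
    (tendsto_cut u)

/-- A closed subspace of the domain which contains all truncations is the whole domain. -/
theorem mem_cl_of_cut (hD : 𝓔.IsDirichletForm) {V : Submodule ℝ (Lp ℝ 2 m)}
    (h : ∀ u ∈ 𝓔.dom, ∀ n, cut n u ∈ hD.cl V) {u : Lp ℝ 2 m} (hu : u ∈ 𝓔.dom) : u ∈ hD.cl V := by
  have hpos : ∀ v ∈ 𝓔.dom, Lp.posPart v ∈ hD.cl V := fun v hv =>
    (hD.mem_cl_of_tendsto (h v hv) (fun n => (hD.cut_mem n hv).2) (tendsto_cut v)).1
  rw [← posPart_sub_posPart_neg u]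
  exact Submodule.sub_mem _ (hpos u hu) (hpos _ (hD.neg_mem hu))

theorem mem_cl_of_mem (hD : 𝓔.IsDirichletForm) {V : Submodule ℝ (Lp ℝ 2 m)} {u : Lp ℝ 2 m}
    (hu : u ∈ 𝓔.dom) (h : u ∈ V) : u ∈ hD.cl V := by
  obtain ⟨x, rfl⟩ := hD.exists_incl hu
  exact ⟨x, subset_closure h, rfl⟩

/-- Elements of the `ℰ₁`-closure are `L²`-limits of `ℰ₁`-bounded sequences. -/
theorem exists_seq_of_mem_cl (hD : 𝓔.IsDirichletForm) {V : Submodule ℝ (Lp ℝ 2 m)}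
    {u : Lp ℝ 2 m} (h : u ∈ hD.cl V) : ∃ v : ℕ → Lp ℝ 2 m, (∀ n, v n ∈ V) ∧ (∀ n, v n ∈ 𝓔.dom) ∧
      (∀ n, 𝓔.form₁ (v n) (v n) ≤ 2 * 𝓔.form₁ u u + 2) ∧ Tendsto v atTop (𝓝 u) := by
  obtain ⟨hu, h⟩ := hD.mem_cl.1 h
  choose v hvV hv hlt using fun n : ℕ => h (1 / ((n : ℝ) + 1)) (by positivity)
  refine ⟨v, hvV, hv, fun n => ?_, ?_⟩
  · have h1 := hD.form₁_sub_le hu (hD.sub_mem hu (hv n))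
    rw [sub_sub_cancel] at h1
    have h2 : 1 / ((n : ℝ) + 1) ≤ 1 := by
      rw [div_le_one (by positivity)]
      linarith [(Nat.cast_nonneg n : (0 : ℝ) ≤ n)]
    linarith [hlt n]
  · rw [tendsto_iff_norm_sub_tendsto_zero]
    have : Tendsto (fun n => ‖v n - u‖ ^ 2) atTop (𝓝 0) := by
      refine squeeze_zero (fun n => by positivity) (fun n => ?_)
        tendsto_one_div_add_atTop_nhds_zero_nat
      rw [norm_sub_rev]
      exact (hD.norm_sq_le_form₁ (hD.sub_mem hu (hv n))).trans (hlt n).le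
    simpa using this.sqrt

/-- Rapidly decreasing sequences have a common dominating element of the domain. -/
theorem exists_dominating (hD : 𝓔.IsDirichletForm) {z : ℕ → Lp ℝ 2 m} (hz : ∀ n, z n ∈ 𝓔.dom)
    (hs : ∀ n, 𝓔.form₁ (z n) (z n) ≤ ((1 / 4) ^ n) ^ 2) :
    ∃ h ∈ 𝓔.dom, ∀ᵐ x ∂m, ∀ n, 2 ^ n * |z n x| ≤ h x := by
  have habs : ∀ n, ∃ y : hD.Hilb, hD.incl y = Lp.posPart (z n) + Lp.posPart (-z n) ∧
      ‖y‖ ≤ 2 * (1 / 4) ^ n := by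
    intro n
    have key : ∀ w ∈ 𝓔.dom, 𝓔.form₁ w w ≤ ((1 / 4) ^ n) ^ 2 → ∃ y : hD.Hilb,
        hD.incl y = Lp.posPart w ∧ ‖y‖ ≤ (1 / 4) ^ n := by
      intro w hw hle
      obtain ⟨h1, h2⟩ := hD.posPart_mem hw
      obtain ⟨y, hy⟩ := hD.exists_incl h1
      refine ⟨y, hy, le_of_sq_le_sq ?_ (by positivity)⟩
      rw [norm_sq, hy]
      exact h2.trans hle
    obtain ⟨a, ha, ha'⟩ := key _ (hz n) (hs n)
    obtain ⟨b, hb, hb'⟩ := key _ (hD.neg_mem (hz n)) (by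
      have := hD.form₁_smul (-1) (hz n)
      simp only [neg_smul, one_smul] at this
      rw [this]
      simpa using hs n)
    refine ⟨a + b, by rw [map_add, ha, hb], ?_⟩
    calc ‖a + b‖ ≤ ‖a‖ + ‖b‖ := norm_add_le _ _
      _ ≤ 2 * (1 / 4) ^ n := by linarith
  choose y hy hyn using habs
  -- The weighted norms are at most `2 · 2⁻ⁿ`, hence summable. All terms are nonnegative, so the sum
  -- dominates each of them and serves as `h`.
  have hsum : Summable (fun n => (2 : ℝ) ^ n • y n) := by
    refine Summable.of_norm_bounded (g := fun n => 2 * (1 / 2 : ℝ) ^ n)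
      (Summable.mul_left _ summable_geometric_two) (fun n => ?_)
    rw [norm_smul, norm_pow, Real.norm_ofNat]
    calc (2 : ℝ) ^ n * ‖y n‖ ≤ 2 ^ n * (2 * (1 / 4) ^ n) := by gcongr; exact hyn n
      _ = 2 * (1 / 2 : ℝ) ^ n := by
        rw [mul_left_comm, ← mul_pow]; norm_num
  have hsum' := (hsum.hasSum.mapL hD.inclL)
  have hcoe : ∀ n, ∀ᵐ x ∂m, hD.incl (y n) x = |z n x| := by
    intro n
    rw [hy]
    filter_upwards [Lp.coeFn_posPart (z n), Lp.coeFn_posPart (-z n), Lp.coeFn_neg (z n),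
      Lp.coeFn_add (Lp.posPart (z n)) (Lp.posPart (-z n))] with x h1 h2 h3 h4
    rw [h4, Pi.add_apply, h1, h2, h3, Pi.neg_apply]
    rcases le_total (z n x) 0 with h | h
    · simp [h, abs_of_nonpos h]
    · simp [h, abs_of_nonneg h]
  have hterm : ∀ n, ∀ᵐ x ∂m, hD.inclL ((2 : ℝ) ^ n • y n) x = 2 ^ n * |z n x| := by
    intro n
    rw [map_smul]
    filter_upwards [hcoe n, Lp.coeFn_smul ((2 : ℝ) ^ n) (hD.inclL (y n))] with x h1 h2
    rw [h2, Pi.smul_apply, inclL_apply, h1, smul_eq_mul]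
  have hnn : ∀ n, 0 ≤ hD.inclL ((2 : ℝ) ^ n • y n) := by
    intro n
    rw [← Lp.coeFn_nonneg]
    filter_upwards [hterm n] with x h
    rw [h]
    simp only [Pi.zero_apply]
    positivity
  refine ⟨_, hD.incl_mem (∑' n, (2 : ℝ) ^ n • y n), ?_⟩
  rw [ae_all_iff]
  intro n
  have hle : hD.inclL ((2 : ℝ) ^ n • y n) ≤ hD.inclL (∑' n, (2 : ℝ) ^ n • y n) :=
    le_hasSum hsum' n (fun j _ => hnn j)
  rw [← Lp.coeFn_le] at hle
  filter_upwards [hterm n, hle] with x h1 h2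
  rw [← h1]
  exact h2

end IsDirichletForm

/-! ### Nests. -/

/-- The elements of the domain vanishing outside some member of an increasing sequence of sets. -/
def vanishing (hD : 𝓔.IsDirichletForm) {F : ℕ → Set E} (hF : Monotone F) :
    Submodule ℝ (Lp ℝ 2 m) where
  carrier := {v | v ∈ 𝓔.dom ∧ ∃ k, ∀ᵐ x ∂m, x ∉ F k → v x = 0}
  zero_mem' := ⟨hD.zero_mem, 0, by
    filter_upwards [Lp.coeFn_zero ℝ 2 m] with x hx _
    rw [hx]; rfl⟩
  add_mem' := by
    rintro a b ⟨ha, i, hai⟩ ⟨hb, j, hbj⟩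
    refine ⟨hD.add_mem _ ha _ hb, max i j, ?_⟩
    filter_upwards [hai, hbj, Lp.coeFn_add a b] with x h1 h2 h3 hx
    rw [h3, Pi.add_apply, h1 fun h => hx (hF (le_max_left i j) h),
      h2 fun h => hx (hF (le_max_right i j) h), add_zero]
  smul_mem' := by
    rintro c a ⟨ha, i, hai⟩
    refine ⟨hD.smul_mem _ _ ha, i, ?_⟩
    filter_upwards [hai, Lp.coeFn_smul c a] with x h1 h2 hx
    rw [h2, Pi.smul_apply, h1 hx, smul_zero]

section Nest

variable [TopologicalSpace E]

theorem isNest_iff (hD : 𝓔.IsDirichletForm) {F : ℕ → Set E} (hF : Monotone F)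
    (hc : ∀ k, IsClosed (F k)) :
    𝓔.IsNest F ↔ ∀ u ∈ 𝓔.dom, u ∈ hD.cl (vanishing hD hF) := by
  constructor
  · intro h u hu
    refine hD.mem_cl.2 ⟨hu, fun ε hε => ?_⟩
    obtain ⟨k, v, hv, hv0, hlt⟩ := h.dense u hu ε hε
    exact ⟨v, ⟨hv, k, hv0⟩, hv, hlt⟩
  · intro h
    refine ⟨hF, hc, fun u hu ε hε => ?_⟩
    obtain ⟨v, ⟨hv, k, hv0⟩, -, hlt⟩ := (hD.mem_cl.1 (h u hu)).2 ε hε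
    exact ⟨k, v, hv, hv0, hlt⟩

/-- Vanishing off `F k` is an `m`-a.e. condition, so the sets of a nest may lose `m`-null pieces.
This allows passing to supports of `m` restricted to `F k`. -/
theorem IsNest.of_ae {F G : ℕ → Set E} (hF : 𝓔.IsNest F) (hG : Monotone G)
    (hc : ∀ k, IsClosed (G k)) (h : ∀ k, ∀ᵐ x ∂m, x ∈ F k → x ∈ G k) : 𝓔.IsNest G := by
  refine ⟨hG, hc, fun u hu ε hε => ?_⟩
  obtain ⟨k, v, hv, hv0, hlt⟩ := hF.dense u hu ε hε
  refine ⟨k, v, hv, ?_, hlt⟩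
  filter_upwards [hv0, h k] with x h1 h2 hx
  exact h1 fun h => hx (h2 h)

theorem isNest_univ (hD : 𝓔.IsDirichletForm) : 𝓔.IsNest fun _ => Set.univ :=
  (isNest_iff hD monotone_const fun _ => isClosed_univ).2 fun _ hu =>
    hD.mem_cl_of_mem hu ⟨hu, 0, by simp⟩

/-- A sequence of closed sets is a nest as soon as some element of the domain tends to infinity on
the complements. -/
theorem isNest_of_le (hD : 𝓔.IsDirichletForm) {G : ℕ → Set E} (hG : Monotone G)
    (hc : ∀ k, IsClosed (G k)) {h : Lp ℝ 2 m} (hh : h ∈ 𝓔.dom)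
    (hle : ∀ k : ℕ, ∀ᵐ x ∂m, x ∉ G k → (k : ℝ) ≤ h x) : 𝓔.IsNest G := by
  rw [isNest_iff hD hG hc]
  intro u hu
  refine hD.mem_cl_of_cut (fun u hu n => ?_) hu
  obtain ⟨hb, -⟩ := hD.cut_mem n hu
  set b := cut n u with hbdef
  -- The approximants of `b` are `(b - c k • h)⁺`. Off `G (k + 1)` one has `h ≥ k + 1`, so `c k * h
  -- ≥ n ≥ b` and the approximant vanishes there. As `c k → 0` it tends to `b`, and `c k ≤ n` bounds
  -- the energies. The shift to `k + 1` avoids division by zero.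
  let c : ℕ → ℝ := fun k => n * (1 / ((k : ℝ) + 1))
  have hc0 : Tendsto c atTop (𝓝 0) := by
    simpa [c] using tendsto_one_div_add_atTop_nhds_zero_nat.const_mul (n : ℝ)
  have hcn : ∀ k, 0 ≤ c k ∧ c k ≤ n := by
    intro k
    refine ⟨by positivity, ?_⟩
    have : 1 / ((k : ℝ) + 1) ≤ 1 := by
      rw [div_le_one (by positivity)]
      linarith [(Nat.cast_nonneg k : (0 : ℝ) ≤ k)]
    exact mul_le_of_le_one_right (Nat.cast_nonneg n) this
  have hmem : ∀ k, b - c k • h ∈ 𝓔.dom := fun k => hD.sub_mem hb (hD.smul_mem _ _ hh)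
  have hlim : Tendsto (fun k => Lp.posPart (b - c k • h)) atTop (𝓝 b) := by
    have h1 : Tendsto (fun k => b - c k • h) atTop (𝓝 b) := by
      simpa using (tendsto_const_nhds (x := b)).sub (hc0.smul_const h)
    have h2 := (Lp.continuous_posPart (p := 2) (μ := m)).continuousAt.tendsto.comp h1
    have h3 : Lp.posPart b = b := by
      refine Lp.ext ?_
      filter_upwards [Lp.coeFn_posPart b, coeFn_cut n u] with x h4 h5
      rw [h4, h5, max_eq_left (cutFun_nonneg _ _)]
    rwa [h3] at h2
  refine (hD.mem_cl_of_tendsto (w := fun k => Lp.posPart (b - c k • h))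
    (C := 2 * 𝓔.form₁ b b + 2 * (n ^ 2 * 𝓔.form₁ h h)) (fun k => ?_) (fun k => ?_) hlim).1
  · have hd := (hD.posPart_mem (hmem k)).1
    refine hD.mem_cl_of_mem hd ⟨hd, k + 1, ?_⟩
    filter_upwards [hle (k + 1), Lp.coeFn_posPart (b - c k • h), Lp.coeFn_sub b (c k • h),
      Lp.coeFn_smul (c k) h, coeFn_cut n u] with x h1 h2 h3 h4 h5 hx
    rw [h2, h3, Pi.sub_apply, h4, Pi.smul_apply, h5, smul_eq_mul]
    refine max_eq_right ?_
    have h6 := h1 hx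
    have h7 := cutFun_le n (u x)
    have h8 : (n : ℝ) ≤ c k * h x := by
      calc (n : ℝ) = c k * ((k + 1 : ℕ) : ℝ) := by
            simp only [c]; push_cast; field_simp
        _ ≤ _ := by gcongr
    linarith
  · refine (hD.posPart_mem (hmem k)).2.trans ((hD.form₁_sub_le hb (hD.smul_mem _ _ hh)).trans ?_)
    rw [hD.form₁_smul _ hh]
    have := hD.form₁_nonneg hh
    have h1 := (hcn k).1
    have h2 := (hcn k).2
    gcongr

theorem IsNest.inter (hD : 𝓔.IsDirichletForm) {F G : ℕ → Set E} (hF : 𝓔.IsNest F)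
    (hG : 𝓔.IsNest G) : 𝓔.IsNest fun k => F k ∩ G k := by
  have hmono : Monotone fun k => F k ∩ G k := fun i j hij =>
    Set.inter_subset_inter (hF.mono hij) (hG.mono hij)
  rw [isNest_iff hD hmono fun k => (hF.closed k).inter (hG.closed k)]
  have hpos : ∀ u ∈ 𝓔.dom, Lp.posPart u ∈ hD.cl (vanishing hD hmono) := by
    intro u hu
    obtain ⟨v, hv0, hv, hvC, hvu⟩ := hD.exists_seq_of_mem_cl
      ((isNest_iff hD hF.mono hF.closed).1 hF u hu)
    obtain ⟨w, hw0, hw, hwC, hwu⟩ := hD.exists_seq_of_mem_cl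
      ((isNest_iff hD hG.mono hG.closed).1 hG u hu)
    -- This is `v⁺ ∧ w⁺`, written with positive parts only. It vanishes wherever `v` or `w` does,
    -- and it tends to `u⁺` because both do.
    let z : ℕ → Lp ℝ 2 m := fun n =>
      Lp.posPart (v n) - Lp.posPart (Lp.posPart (v n) - Lp.posPart (w n))
    have hcont := Lp.continuous_posPart (p := 2) (μ := m)
    have hz : Tendsto z atTop (𝓝 (Lp.posPart u)) := by
      have h1 := hcont.continuousAt.tendsto.comp hvu
      have h2 := hcont.continuousAt.tendsto.comp hwu
      have h3 := h1.sub (hcont.continuousAt.tendsto.comp (h1.sub h2))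
      have h4 : Lp.posPart (0 : Lp ℝ 2 m) = 0 := by
        refine Lp.ext ?_
        filter_upwards [Lp.coeFn_posPart (0 : Lp ℝ 2 m), Lp.coeFn_zero ℝ 2 m] with x h5 h6
        rw [h5, h6]
        simp
      rw [sub_self, h4, sub_zero] at h3
      exact h3
    have hd : ∀ n, Lp.posPart (v n) - Lp.posPart (w n) ∈ 𝓔.dom := fun n =>
      hD.sub_mem (hD.posPart_mem (hv n)).1 (hD.posPart_mem (hw n)).1
    have hzd : ∀ n, z n ∈ 𝓔.dom := fun n =>
      hD.sub_mem (hD.posPart_mem (hv n)).1 (hD.posPart_mem (hd n)).1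
    -- With `A = 2 ℰ₁(u, u) + 2` bounding the energies of `v n` and `w n`, that of `v⁺ - w⁺` is at
    -- most `4A`, so that of `z n` is at most `2A + 2 · 4A = 10A`.
    refine (hD.mem_cl_of_tendsto (w := z) (C := 10 * (2 * 𝓔.form₁ u u + 2)) (fun n => ?_)
      (fun n => ?_) hz).1
    · refine hD.mem_cl_of_mem (hzd n) ⟨hzd n, ?_⟩
      obtain ⟨-, i, hi⟩ := hv0 n
      obtain ⟨-, j, hj⟩ := hw0 n
      refine ⟨max i j, ?_⟩
      filter_upwards [hi, hj, Lp.coeFn_posPart (v n), Lp.coeFn_posPart (w n),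
        Lp.coeFn_posPart (Lp.posPart (v n) - Lp.posPart (w n)),
        Lp.coeFn_sub (Lp.posPart (v n)) (Lp.posPart (w n)),
        Lp.coeFn_sub (Lp.posPart (v n)) (Lp.posPart (Lp.posPart (v n) - Lp.posPart (w n)))]
        with x h1 h2 h3 h4 h5 h6 h7 hx
      rw [h7, Pi.sub_apply, h5, h6, Pi.sub_apply, h3, h4]
      by_cases hxi : x ∈ F (max i j)
      · have hxj : x ∉ G (max i j) := fun h => hx ⟨hxi, h⟩
        rw [h2 fun h => hxj (hG.mono (le_max_right i j) h)]
        simp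
      · rw [h1 fun h => hxi (hF.mono (le_max_left i j) h)]
        simp
    · have h1 := hD.form₁_sub_le (hD.posPart_mem (hv n)).1 (hD.posPart_mem (hd n)).1
      have h2 := hD.form₁_sub_le (hD.posPart_mem (hv n)).1 (hD.posPart_mem (hw n)).1
      have h3 := (hD.posPart_mem (hd n)).2
      have h4 := (hD.posPart_mem (hv n)).2
      have h5 := (hD.posPart_mem (hw n)).2
      have h6 := hvC n
      have h7 := hwC n
      simp only [z]
      linarith
  intro u hu
  rw [← posPart_sub_posPart_neg u]
  exact Submodule.sub_mem _ (hpos u hu) (hpos _ (hD.neg_mem hu))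

/-! ### Quasi-continuous functions and exceptional sets. -/

/-- Real-valued quasi-continuous functions. -/
def QC (𝓔 : FormPair m) (f : E → ℝ) : Prop :=
  ∃ F : ℕ → Set E, 𝓔.IsNest F ∧ ∀ k, ContinuousOn f (F k)

theorem isQuasiContinuous_coe_iff {f : E → ℝ} :
    𝓔.IsQuasiContinuous (fun x => (f x : EReal)) ↔ 𝓔.QC f := by
  refine exists_congr fun F => and_congr_right fun _ => forall_congr' fun k => ?_
  simp only [ne_eq, EReal.coe_ne_bot, EReal.coe_ne_top, not_false_eq_true, and_self,
    implies_true, and_true]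
  exact (EReal.isEmbedding_coe.continuousOn_iff (f := f)).symm

theorem QC.of_continuous (hD : 𝓔.IsDirichletForm) {f : E → ℝ} (hf : Continuous f) : 𝓔.QC f :=
  ⟨_, isNest_univ hD, fun _ => hf.continuousOn⟩

theorem QC.comp₂ (hD : 𝓔.IsDirichletForm) {f g : E → ℝ} (hf : 𝓔.QC f) (hg : 𝓔.QC g)
    {φ : ℝ × ℝ → ℝ} (hφ : Continuous φ) : 𝓔.QC fun x => φ (f x, g x) := by
  obtain ⟨F, hF, hfc⟩ := hf
  obtain ⟨G, hG, hgc⟩ := hg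
  refine ⟨_, hF.inter hD hG, fun k => hφ.comp_continuousOn ?_⟩
  exact ((hfc k).mono Set.inter_subset_left).prodMk ((hgc k).mono Set.inter_subset_right)

theorem QC.comp {f : E → ℝ} (hf : 𝓔.QC f) {φ : ℝ → ℝ} (hφ : Continuous φ) :
    𝓔.QC fun x => φ (f x) := by
  obtain ⟨F, hF, hfc⟩ := hf
  exact ⟨F, hF, fun k => hφ.comp_continuousOn (hfc k)⟩

/-- A quasi-continuous function vanishing almost everywhere vanishes outside a polar set. -/
theorem QC.isPolar_ne_zero [SecondCountableTopology E] {f : E → ℝ} (hf : 𝓔.QC f)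
    (h0 : f =ᵐ[m] 0) : 𝓔.IsPolar {x | f x ≠ 0} := by
  obtain ⟨F, hF, hfc⟩ := hf
  -- `G k` is the support of `m` restricted to `F k`. It differs from `F k` by an `m`-null set
  -- (second countability), so `G` is still a nest. If `f x ≠ 0` at some `x ∈ G k`, then by
  -- continuity `f ≠ 0` on a relative neighbourhood of `x` in `F k`, which has positive measure.
  let G : ℕ → Set E := fun k => {x | ∀ U ∈ 𝓝 x, m (U ∩ F k) ≠ 0}
  have hGF : ∀ k, G k ⊆ F k := by
    intro k x hx
    by_contra hxF
    refine hx _ ((hF.closed k).isOpen_compl.mem_nhds hxF) ?_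
    simp
  have hGc : ∀ k, IsClosed (G k) := by
    intro k
    rw [← isOpen_compl_iff, isOpen_iff_mem_nhds]
    intro x hx
    simp only [G, Set.mem_compl_iff, Set.mem_ofPred_eq, not_forall, not_not] at hx
    obtain ⟨U, hU, hm⟩ := hx
    filter_upwards [eventually_mem_nhds_iff.2 hU] with y hy hyG
    exact hyG U hy hm
  have hGm : Monotone G := fun i j hij x hx U hU h =>
    hx U hU (measure_mono_null (Set.inter_subset_inter_right _ (hF.mono hij)) h)
  refine ⟨G, hF.of_ae hGm hGc fun k => ?_, ?_⟩
  · have : m (F k \ G k) = 0 := by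
      refine measure_null_of_locally_null _ fun x hx => ?_
      have hxG := hx.2
      simp only [G, Set.mem_ofPred_eq, not_forall, not_not] at hxG
      obtain ⟨U, hU, hm⟩ := hxG
      refine ⟨U ∩ (F k \ G k), inter_mem (mem_nhdsWithin_of_mem_nhds hU) self_mem_nhdsWithin, ?_⟩
      exact measure_mono_null (Set.inter_subset_inter_right _ Set.sdiff_subset) hm
    filter_upwards [measure_eq_zero_iff_ae_notMem.1 this] with x hx hxF
    by_contra hxG
    exact hx ⟨hxF, hxG⟩
  · intro x hx
    rw [Set.mem_iInter]
    intro k hxG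
    have hxF := hGF k hxG
    have hev : ∀ᶠ y in 𝓝[F k] x, f y ≠ 0 :=
      (hfc k x hxF).eventually (isOpen_ne.mem_nhds hx)
    rw [eventually_nhdsWithin_iff] at hev
    refine hxG _ hev (measure_mono_null (fun y hy => ?_) (ae_iff.1 h0))
    exact hy.1 hy.2

/-- Almost everywhere inequalities between quasi-continuous functions hold quasi-everywhere. -/
theorem QC.isPolar_not_le [SecondCountableTopology E] (hD : 𝓔.IsDirichletForm) {f g : E → ℝ}
    (hf : 𝓔.QC f) (hg : 𝓔.QC g) (h : ∀ᵐ x ∂m, f x ≤ g x) : 𝓔.IsPolar {x | ¬ f x ≤ g x} := by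
  have hqc := hf.comp₂ hD hg (φ := fun p => max (p.1 - p.2) 0) (by fun_prop)
  obtain ⟨F, hF, hsub⟩ := hqc.isPolar_ne_zero (by
    filter_upwards [h] with x hx
    simp [hx])
  refine ⟨F, hF, fun x hx => hsub ?_⟩
  have : 0 < f x - g x := by simpa using hx
  exact (lt_max_of_lt_left this).ne'

end Nest

variable [TopologicalSpace E]

/-! ### Regular forms and existence of quasi-continuous versions. -/

/-- The elements of the domain represented by continuous functions of compact support. -/
def ccSubmodule (hD : 𝓔.IsDirichletForm) : Submodule ℝ (Lp ℝ 2 m) where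
  carrier := {v | v ∈ 𝓔.dom ∧ ∃ g : E → ℝ, Continuous g ∧ HasCompactSupport g ∧ v =ᵐ[m] g}
  zero_mem' := ⟨hD.zero_mem, 0, continuous_zero, HasCompactSupport.zero, Lp.coeFn_zero ℝ 2 m⟩
  add_mem' := by
    rintro a b ⟨ha, f, hf, hfc, haf⟩ ⟨hb, g, hg, hgc, hbg⟩
    exact ⟨hD.add_mem _ ha _ hb, f + g, hf.add hg, hfc.add hgc,
      (Lp.coeFn_add a b).trans (haf.add hbg)⟩
  smul_mem' := by
    rintro c a ⟨ha, f, hf, hfc, haf⟩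
    exact ⟨hD.smul_mem _ _ ha, c • f, hf.const_smul c, hfc.smul_left (f := fun _ => c),
      (Lp.coeFn_smul c a).trans (haf.const_smul c)⟩

theorem mem_cl_ccSubmodule (hD : 𝓔.IsDirichletForm) (hR : 𝓔.IsRegular) {u : Lp ℝ 2 m}
    (hu : u ∈ 𝓔.dom) : u ∈ hD.cl (ccSubmodule hD) := by
  refine hD.mem_cl.2 ⟨hu, fun ε hε => ?_⟩
  obtain ⟨v, hv, hg, hlt⟩ := hR.dense_dom u hu ε hε
  exact ⟨v, ⟨hv, hg⟩, hv, hlt⟩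

/-- Every element of the domain of a regular Dirichlet form has a quasi-continuous version. -/
theorem exists_qc_version (hD : 𝓔.IsDirichletForm) (hR : 𝓔.IsRegular) {u : Lp ℝ 2 m}
    (hu : u ∈ 𝓔.dom) : ∃ f : E → ℝ, 𝓔.QC f ∧ u =ᵐ[m] f := by
  choose w hw g hlt using fun n : ℕ => hR.dense_dom u hu (((1 / 4) ^ (n + 1)) ^ 2) (by positivity)
  choose g hg _ hwg using g
  have hz : ∀ n, 𝓔.form₁ (w n - w (n + 1)) (w n - w (n + 1)) ≤ ((1 / 4) ^ n) ^ 2 := by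
    intro n
    have h1 := hD.form₁_sub_le (hD.sub_mem hu (hw (n + 1))) (hD.sub_mem hu (hw n))
    rw [sub_sub_sub_cancel_left] at h1
    have h2 := hlt n
    have h3 := hlt (n + 1)
    have h4 : (0 : ℝ) < ((1 / 4) ^ n) ^ 2 := by positivity
    rw [pow_succ (1 / 4 : ℝ), mul_pow] at h2
    rw [pow_succ (1 / 4 : ℝ), pow_succ (1 / 4 : ℝ), mul_pow, mul_pow] at h3
    linarith
  obtain ⟨h, hh, hle⟩ := hD.exists_dominating (fun n => hD.sub_mem (hw n) (hw (n + 1))) hz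
  have hle' : ∀ᵐ x ∂m, ∀ n, 2 ^ n * |g n x - g (n + 1) x| ≤ h x := by
    filter_upwards [hle, ae_all_iff.2 hwg,
      ae_all_iff.2 fun n => Lp.coeFn_sub (w n) (w (n + 1))] with x h1 h2 h3 n
    rw [← h2, ← h2, ← Pi.sub_apply, ← h3]
    exact h1 n
  -- The sets are cut out by the continuous `g n`, hence closed, and they form a nest because `h`
  -- exceeds `k` a.e. off `G k`. On `G k` the sequence `g` is uniformly Cauchy.
  let G : ℕ → Set E := fun k => {x | ∀ n, 2 ^ n * |g n x - g (n + 1) x| ≤ k}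
  have hG : 𝓔.IsNest G := by
    refine isNest_of_le hD (fun i j hij x hx n => (hx n).trans (by exact_mod_cast hij))
      (fun k => ?_) hh fun k => ?_
    · have : G k = ⋂ n, {x | 2 ^ n * |g n x - g (n + 1) x| ≤ k} := by
        ext x; simp [G]
      rw [this]
      refine isClosed_iInter fun n => isClosed_le ?_ continuous_const
      exact continuous_const.mul ((hg n).sub (hg (n + 1))).abs
    · filter_upwards [hle'] with x h1 hx
      simp only [G, Set.mem_ofPred_eq, not_forall, not_le] at hx
      obtain ⟨n, hn⟩ := hx
      exact hn.le.trans (h1 n)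
  -- The arbitrary value of `limUnder` is taken only at points of divergence, which lie outside
  -- every `G k`.
  let f : E → ℝ := fun x => limUnder atTop fun n => g n x
  have hlim : ∀ (x : E) (C : ℝ), (∀ n, 2 ^ n * |g n x - g (n + 1) x| ≤ C) →
      Tendsto (fun n => g n x) atTop (𝓝 (f x)) ∧ ∀ n, dist (g n x) (f x) ≤ 2 * C / 2 ^ n := by
    intro x C hC
    have hd : ∀ n, dist (g n x) (g (n + 1) x) ≤ 2 * C / 2 / 2 ^ n := by
      intro n
      rw [Real.dist_eq, le_div_iff₀ (by positivity), mul_comm]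
      linarith [hC n]
    have ht : Tendsto (fun n => g n x) atTop (𝓝 (f x)) :=
      (cauchySeq_of_le_geometric_two hd).tendsto_limUnder
    exact ⟨ht, fun n => dist_le_of_le_geometric_two_of_tendsto hd ht n⟩
  refine ⟨f, ⟨G, hG, fun k => ?_⟩, ?_⟩
  · have hunif : TendstoUniformlyOn g f atTop (G k) := by
      rw [Metric.tendstoUniformlyOn_iff]
      intro ε hε
      have h0 : Tendsto (fun n : ℕ => 2 * (k : ℝ) / 2 ^ n) atTop (𝓝 0) :=
        tendsto_const_nhds.div_atTop (tendsto_pow_atTop_atTop_of_one_lt one_lt_two)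
      filter_upwards [h0.eventually (gt_mem_nhds hε)] with n hn x hx
      rw [dist_comm]
      exact ((hlim x k hx).2 n).trans_lt hn
    exact hunif.continuousOn (Frequently.of_forall fun n => (hg n).continuousOn)
  · have hwu : Tendsto w atTop (𝓝 u) := by
      rw [tendsto_iff_norm_sub_tendsto_zero]
      refine squeeze_zero (g := fun n => (1 / 4 : ℝ) ^ (n + 1)) (fun n => norm_nonneg _)
        (fun n => ?_) ((tendsto_pow_atTop_nhds_zero_of_lt_one (by norm_num) (by norm_num)).comp
          (tendsto_add_atTop_nat 1))
      rw [norm_sub_rev]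
      exact le_of_sq_le_sq ((hD.norm_sq_le_form₁ (hD.sub_mem hu (hw n))).trans (hlt n).le)
        (by positivity)
    obtain ⟨φ, hφ, hae⟩ := (tendstoInMeasure_of_tendsto_Lp hwu).exists_seq_tendsto_ae
    filter_upwards [hae, hle', ae_all_iff.2 hwg] with x h1 h2 h3
    simp only [h3] at h1
    exact tendsto_nhds_unique h1 ((hlim x _ h2).1.comp hφ.tendsto_atTop)

theorem qcVersion_spec (hD : 𝓔.IsDirichletForm) (hR : 𝓔.IsRegular) {u : Lp ℝ 2 m}
    (hu : u ∈ 𝓔.dom) : 𝓔.QC (𝓔.qcVersion u) ∧ u =ᵐ[m] 𝓔.qcVersion u := by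
  have h : ∃ f : E → ℝ, 𝓔.IsQCVersion u f := by
    obtain ⟨f, hf, hfu⟩ := exists_qc_version hD hR hu
    exact ⟨f, isQuasiContinuous_coe_iff.2 hf, hfu⟩
  rw [qcVersion, dif_pos h]
  exact ⟨isQuasiContinuous_coe_iff.1 h.choose_spec.1, h.choose_spec.2⟩

/-! ### Quasi-continuous versions modulo `μ`. -/

section Smooth

variable {μ : Measure E}

theorem QC.ae_le [SecondCountableTopology E] (hD : 𝓔.IsDirichletForm)
    (hμ : ∀ N : Set E, 𝓔.IsPolar N → μ N = 0) {f g : E → ℝ} (hf : 𝓔.QC f) (hg : 𝓔.QC g)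
    (h : ∀ᵐ x ∂m, f x ≤ g x) : ∀ᵐ x ∂μ, f x ≤ g x :=
  hμ _ (hf.isPolar_not_le hD hg h)

theorem QC.ae_eq [SecondCountableTopology E] (hD : 𝓔.IsDirichletForm)
    (hμ : ∀ N : Set E, 𝓔.IsPolar N → μ N = 0) {f g : E → ℝ} (hf : 𝓔.QC f) (hg : 𝓔.QC g)
    (h : f =ᵐ[m] g) : f =ᵐ[μ] g := by
  filter_upwards [hf.ae_le hD hμ hg h.le, hg.ae_le hD hμ hf h.symm.le] with x h1 h2
  exact le_antisymm h1 h2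

/-- Borel measurability is clear on each closed `F k`; what the nest leaves uncovered is polar,
hence `μ`-null. -/
theorem QC.aemeasurable [BorelSpace E] (hμ : ∀ N : Set E, 𝓔.IsPolar N → μ N = 0) {f : E → ℝ}
    (hf : 𝓔.QC f) : AEMeasurable f μ := by
  obtain ⟨F, hF, hfc⟩ := hf
  have h0 : μ (⋂ k, (F k)ᶜ) = 0 := hμ _ ⟨F, hF, subset_rfl⟩
  have hr : μ.restrict (⋃ k, F k) = μ := by
    refine Measure.restrict_eq_self_of_ae_mem ?_
    filter_upwards [measure_eq_zero_iff_ae_notMem.1 h0] with x hx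
    simpa using hx
  rw [← hr, aemeasurable_iUnion_iff]
  exact fun k => (hfc k).aemeasurable (hF.closed k).measurableSet

variable [SecondCountableTopology E]

/-- This makes the choice of version harmless: modulo `μ` any quasi-continuous version may be
substituted, whence the rules for sums, multiples and truncations. -/
theorem qcVersion_ae_eq (hD : 𝓔.IsDirichletForm) (hR : 𝓔.IsRegular)
    (hμ : ∀ N : Set E, 𝓔.IsPolar N → μ N = 0) {u : Lp ℝ 2 m} (hu : u ∈ 𝓔.dom) {f : E → ℝ}
    (hf : 𝓔.QC f) (h : u =ᵐ[m] f) : 𝓔.qcVersion u =ᵐ[μ] f :=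
  (qcVersion_spec hD hR hu).1.ae_eq hD hμ hf ((qcVersion_spec hD hR hu).2.symm.trans h)

theorem qcVersion_add (hD : 𝓔.IsDirichletForm) (hR : 𝓔.IsRegular)
    (hμ : ∀ N : Set E, 𝓔.IsPolar N → μ N = 0) {u v : Lp ℝ 2 m} (hu : u ∈ 𝓔.dom)
    (hv : v ∈ 𝓔.dom) :
    𝓔.qcVersion (u + v) =ᵐ[μ] fun x => 𝓔.qcVersion u x + 𝓔.qcVersion v x := by
  obtain ⟨hu1, hu2⟩ := qcVersion_spec hD hR hu
  obtain ⟨hv1, hv2⟩ := qcVersion_spec hD hR hv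
  refine qcVersion_ae_eq hD hR hμ (hD.add_mem _ hu _ hv)
    (hu1.comp₂ hD hv1 (φ := fun p => p.1 + p.2) (by fun_prop)) ?_
  filter_upwards [Lp.coeFn_add u v, hu2, hv2] with x h1 h2 h3
  rw [h1, Pi.add_apply, h2, h3]

theorem qcVersion_smul (hD : 𝓔.IsDirichletForm) (hR : 𝓔.IsRegular)
    (hμ : ∀ N : Set E, 𝓔.IsPolar N → μ N = 0) (c : ℝ) {u : Lp ℝ 2 m} (hu : u ∈ 𝓔.dom) :
    𝓔.qcVersion (c • u) =ᵐ[μ] fun x => c * 𝓔.qcVersion u x := by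
  obtain ⟨hu1, hu2⟩ := qcVersion_spec hD hR hu
  refine qcVersion_ae_eq hD hR hμ (hD.smul_mem c _ hu)
    (hu1.comp (φ := fun y => c * y) (by fun_prop)) ?_
  filter_upwards [Lp.coeFn_smul c u, hu2] with x h1 h2
  rw [h1, Pi.smul_apply, h2, smul_eq_mul]

theorem qcVersion_sub (hD : 𝓔.IsDirichletForm) (hR : 𝓔.IsRegular)
    (hμ : ∀ N : Set E, 𝓔.IsPolar N → μ N = 0) {u v : Lp ℝ 2 m} (hu : u ∈ 𝓔.dom)
    (hv : v ∈ 𝓔.dom) :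
    𝓔.qcVersion (u - v) =ᵐ[μ] fun x => 𝓔.qcVersion u x - 𝓔.qcVersion v x := by
  have h := qcVersion_add hD hR hμ (hD.sub_mem hu hv) hv
  rw [sub_add_cancel] at h
  filter_upwards [h] with x hx
  rw [hx]; ring

theorem qcVersion_cutFun (hD : 𝓔.IsDirichletForm) (hR : 𝓔.IsRegular)
    (hμ : ∀ N : Set E, 𝓔.IsPolar N → μ N = 0) (n : ℕ) {u v : Lp ℝ 2 m} (hu : u ∈ 𝓔.dom)
    (hv : v ∈ 𝓔.dom) (h : ∀ᵐ x ∂m, v x = cutFun n (u x)) :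
    𝓔.qcVersion v =ᵐ[μ] fun x => cutFun n (𝓔.qcVersion u x) := by
  obtain ⟨hu1, hu2⟩ := qcVersion_spec hD hR hu
  refine qcVersion_ae_eq hD hR hμ hv (hu1.comp (lipschitzWith_cutFun n).continuous) ?_
  filter_upwards [h, hu2] with x h1 h2
  rw [h1, h2]

/-- Quasi-continuous versions converge almost everywhere along rapidly `ℰ₁`-convergent
sequences. -/
theorem ae_tendsto_qcVersion (hD : 𝓔.IsDirichletForm) (hR : 𝓔.IsRegular)
    (hμ : ∀ N : Set E, 𝓔.IsPolar N → μ N = 0) {u : ℕ → Lp ℝ 2 m} {v : Lp ℝ 2 m}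
    (hu : ∀ n, u n ∈ 𝓔.dom) (hv : v ∈ 𝓔.dom)
    (hs : ∀ n, 𝓔.form₁ (u n - v) (u n - v) ≤ ((1 / 4) ^ n) ^ 2) :
    ∀ᵐ x ∂μ, Tendsto (fun n => 𝓔.qcVersion (u n) x) atTop (𝓝 (𝓔.qcVersion v x)) := by
  obtain ⟨h, hh, hle⟩ := hD.exists_dominating (fun n => hD.sub_mem (hu n) hv) hs
  obtain ⟨hh1, hh2⟩ := qcVersion_spec hD hR hh
  obtain ⟨hv1, hv2⟩ := qcVersion_spec hD hR hv
  -- The domination holds `m`-a.e. between quasi-continuous functions, so it passes to `μ`.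
  have hbound : ∀ᵐ x ∂μ, ∀ n,
      2 ^ n * |𝓔.qcVersion (u n) x - 𝓔.qcVersion v x| ≤ 𝓔.qcVersion h x := by
    rw [ae_all_iff]
    intro n
    obtain ⟨hu1, hu2⟩ := qcVersion_spec hD hR (hu n)
    refine QC.ae_le hD hμ
      (hu1.comp₂ hD hv1 (φ := fun p => 2 ^ n * |p.1 - p.2|) (by fun_prop)) hh1 ?_
    filter_upwards [hle, hu2, hv2, hh2, Lp.coeFn_sub (u n) v] with x h1 h2 h3 h4 h5
    rw [← h2, ← h3, ← h4, ← Pi.sub_apply, ← h5]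
    exact h1 n
  filter_upwards [hbound] with x hx
  rw [tendsto_iff_norm_sub_tendsto_zero]
  refine squeeze_zero (g := fun n : ℕ => 𝓔.qcVersion h x / 2 ^ n) (fun n => norm_nonneg _)
    (fun n => ?_) (tendsto_const_nhds.div_atTop (tendsto_pow_atTop_atTop_of_one_lt one_lt_two))
  rw [Real.norm_eq_abs, le_div_iff₀ (by positivity), mul_comm]
  exact hx n

end Smooth

variable {μ : Measure E}

/-! ### The jump energy and the domain of `ℰˢ`. -/

/-- The difference `ũ(x) - ũ(y)` of a quasi-continuous version. -/
noncomputable def diff (𝓔 : FormPair m) (u : Lp ℝ 2 m) (p : E × E) : ℝ :=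
  𝓔.qcVersion u p.1 - 𝓔.qcVersion u p.2

/-- The jump energy `∫∫ (ũ(x) - ũ(y))² μ(dx) μ(dy)`. -/
noncomputable def jump (𝓔 : FormPair m) (μ : Measure E) (u : Lp ℝ 2 m) : ℝ≥0∞ :=
  ∫⁻ p, ENNReal.ofReal (𝓔.diff u p ^ 2) ∂(μ.prod μ)

theorem mem_snap_dom {u : Lp ℝ 2 m} :
    u ∈ (𝓔.snap μ).dom ↔ u ∈ 𝓔.dom ∧ 𝓔.jump μ u < ∞ := Iff.rfl

theorem snap_form (u v : Lp ℝ 2 m) : (𝓔.snap μ).form u v = 𝓔.form u v +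
    1 / (2 * μ.real Set.univ) * ∫ p, 𝓔.diff u p * 𝓔.diff v p ∂(μ.prod μ) := rfl

theorem ae_prod_of_ae [IsFiniteMeasure μ] {P : E → Prop} (h : ∀ᵐ x ∂μ, P x) :
    ∀ᵐ p ∂(μ.prod μ), P p.1 ∧ P p.2 :=
  (Measure.quasiMeasurePreserving_fst.ae h).and (Measure.quasiMeasurePreserving_snd.ae h)

section

variable [IsFiniteMeasure μ] [SecondCountableTopology E] [BorelSpace E]

theorem aestronglyMeasurable_diff (hD : 𝓔.IsDirichletForm) (hR : 𝓔.IsRegular)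
    (hμ : ∀ N : Set E, 𝓔.IsPolar N → μ N = 0) {u : Lp ℝ 2 m} (hu : u ∈ 𝓔.dom) :
    AEStronglyMeasurable (𝓔.diff u) (μ.prod μ) := by
  have h := ((qcVersion_spec hD hR hu).1.aemeasurable hμ).aestronglyMeasurable
  exact (h.comp_quasiMeasurePreserving Measure.quasiMeasurePreserving_fst).sub
    (h.comp_quasiMeasurePreserving Measure.quasiMeasurePreserving_snd)

theorem memLp_diff_iff (hD : 𝓔.IsDirichletForm) (hR : 𝓔.IsRegular)
    (hμ : ∀ N : Set E, 𝓔.IsPolar N → μ N = 0) {u : Lp ℝ 2 m} (hu : u ∈ 𝓔.dom) :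
    MemLp (𝓔.diff u) 2 (μ.prod μ) ↔ 𝓔.jump μ u < ∞ := by
  have hm := aestronglyMeasurable_diff hD hR hμ hu
  have hm2 : AEStronglyMeasurable (fun p => 𝓔.diff u p ^ 2) (μ.prod μ) := hm.pow 2
  rw [memLp_two_iff_integrable_sq hm, Integrable, and_iff_right hm2,
    hasFiniteIntegral_iff_ofReal (Eventually.of_forall fun p => sq_nonneg _)]
  rfl

theorem memLp_diff (hD : 𝓔.IsDirichletForm) (hR : 𝓔.IsRegular)
    (hμ : ∀ N : Set E, 𝓔.IsPolar N → μ N = 0) {u : Lp ℝ 2 m} (hu : u ∈ (𝓔.snap μ).dom) :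
    MemLp (𝓔.diff u) 2 (μ.prod μ) :=
  (memLp_diff_iff hD hR hμ hu.1).2 hu.2

theorem integral_diff_mul_self (hD : 𝓔.IsDirichletForm) (hR : 𝓔.IsRegular)
    (hμ : ∀ N : Set E, 𝓔.IsPolar N → μ N = 0) {u : Lp ℝ 2 m} (hu : u ∈ 𝓔.dom) :
    ∫ p, 𝓔.diff u p * 𝓔.diff u p ∂(μ.prod μ) = (𝓔.jump μ u).toReal := by
  simp only [← sq]
  exact integral_eq_lintegral_of_nonneg_ae (Eventually.of_forall fun p => sq_nonneg _)
    ((aestronglyMeasurable_diff hD hR hμ hu).pow 2)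

theorem snap_form_self (hD : 𝓔.IsDirichletForm) (hR : 𝓔.IsRegular)
    (hμ : ∀ N : Set E, 𝓔.IsPolar N → μ N = 0) {u : Lp ℝ 2 m} (hu : u ∈ 𝓔.dom) :
    (𝓔.snap μ).form u u =
      𝓔.form u u + 1 / (2 * μ.real Set.univ) * (𝓔.jump μ u).toReal := by
  rw [snap_form, integral_diff_mul_self hD hR hμ hu]

theorem snap_form₁_self (hD : 𝓔.IsDirichletForm) (hR : 𝓔.IsRegular)
    (hμ : ∀ N : Set E, 𝓔.IsPolar N → μ N = 0) {u : Lp ℝ 2 m} (hu : u ∈ 𝓔.dom) :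
    (𝓔.snap μ).form₁ u u =
      𝓔.form₁ u u + 1 / (2 * μ.real Set.univ) * (𝓔.jump μ u).toReal := by
  rw [form₁_eq, form₁_eq, snap_form_self hD hR hμ hu]
  ring

theorem form₁_le_snap_form₁ (hD : 𝓔.IsDirichletForm) (hR : 𝓔.IsRegular)
    (hμ : ∀ N : Set E, 𝓔.IsPolar N → μ N = 0) {u : Lp ℝ 2 m} (hu : u ∈ 𝓔.dom) :
    𝓔.form₁ u u ≤ (𝓔.snap μ).form₁ u u := by
  rw [snap_form₁_self hD hR hμ hu]
  have : 0 ≤ 1 / (2 * μ.real Set.univ) * (𝓔.jump μ u).toReal := by positivity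
  linarith

theorem diff_add (hD : 𝓔.IsDirichletForm) (hR : 𝓔.IsRegular)
    (hμ : ∀ N : Set E, 𝓔.IsPolar N → μ N = 0) {u v : Lp ℝ 2 m} (hu : u ∈ 𝓔.dom)
    (hv : v ∈ 𝓔.dom) : 𝓔.diff (u + v) =ᵐ[μ.prod μ] fun p => 𝓔.diff u p + 𝓔.diff v p := by
  filter_upwards [ae_prod_of_ae (qcVersion_add hD hR hμ hu hv)] with p hp
  rw [diff, hp.1, hp.2, diff, diff]
  ring

theorem diff_sub (hD : 𝓔.IsDirichletForm) (hR : 𝓔.IsRegular)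
    (hμ : ∀ N : Set E, 𝓔.IsPolar N → μ N = 0) {u v : Lp ℝ 2 m} (hu : u ∈ 𝓔.dom)
    (hv : v ∈ 𝓔.dom) : 𝓔.diff (u - v) =ᵐ[μ.prod μ] fun p => 𝓔.diff u p - 𝓔.diff v p := by
  filter_upwards [ae_prod_of_ae (qcVersion_sub hD hR hμ hu hv)] with p hp
  rw [diff, hp.1, hp.2, diff, diff]
  ring

theorem diff_smul (hD : 𝓔.IsDirichletForm) (hR : 𝓔.IsRegular)
    (hμ : ∀ N : Set E, 𝓔.IsPolar N → μ N = 0) (c : ℝ) {u : Lp ℝ 2 m} (hu : u ∈ 𝓔.dom) :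
    𝓔.diff (c • u) =ᵐ[μ.prod μ] fun p => c * 𝓔.diff u p := by
  filter_upwards [ae_prod_of_ae (qcVersion_smul hD hR hμ c hu)] with p hp
  rw [diff, hp.1, hp.2, diff]
  ring

theorem snap_add_mem (hD : 𝓔.IsDirichletForm) (hR : 𝓔.IsRegular)
    (hμ : ∀ N : Set E, 𝓔.IsPolar N → μ N = 0) {u v : Lp ℝ 2 m} (hu : u ∈ (𝓔.snap μ).dom)
    (hv : v ∈ (𝓔.snap μ).dom) : u + v ∈ (𝓔.snap μ).dom := by
  have h := hD.add_mem _ hu.1 _ hv.1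
  refine ⟨h, (memLp_diff_iff hD hR hμ h).1 ?_⟩
  exact ((memLp_diff hD hR hμ hu).add (memLp_diff hD hR hμ hv)).ae_eq
    (diff_add hD hR hμ hu.1 hv.1).symm

theorem snap_smul_mem (hD : 𝓔.IsDirichletForm) (hR : 𝓔.IsRegular)
    (hμ : ∀ N : Set E, 𝓔.IsPolar N → μ N = 0) (c : ℝ) {u : Lp ℝ 2 m}
    (hu : u ∈ (𝓔.snap μ).dom) : c • u ∈ (𝓔.snap μ).dom := by
  have h := hD.smul_mem c _ hu.1
  refine ⟨h, (memLp_diff_iff hD hR hμ h).1 ?_⟩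
  exact ((memLp_diff hD hR hμ hu).const_mul c).ae_eq (diff_smul hD hR hμ c hu.1).symm

theorem snap_sub_mem (hD : 𝓔.IsDirichletForm) (hR : 𝓔.IsRegular)
    (hμ : ∀ N : Set E, 𝓔.IsPolar N → μ N = 0) {u v : Lp ℝ 2 m} (hu : u ∈ (𝓔.snap μ).dom)
    (hv : v ∈ (𝓔.snap μ).dom) : u - v ∈ (𝓔.snap μ).dom := by
  rw [sub_eq_add_neg, ← neg_one_smul ℝ v]
  exact snap_add_mem hD hR hμ hu (snap_smul_mem hD hR hμ _ hv)

/-- Elements of the domain with a bounded quasi-continuous version have uniformly bounded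
jump energy. -/
theorem jump_le_of_ae_le {u : Lp ℝ 2 m} {C : ℝ} (h : ∀ᵐ x ∂μ, |𝓔.qcVersion u x| ≤ C) :
    𝓔.jump μ u ≤ ENNReal.ofReal ((2 * C) ^ 2) * (μ.prod μ) Set.univ := by
  rw [← lintegral_const]
  refine lintegral_mono_ae ?_
  filter_upwards [ae_prod_of_ae h] with p hp
  refine ENNReal.ofReal_le_ofReal (sq_le_sq' ?_ ?_)
  · linarith [neg_le_of_abs_le hp.1, le_of_abs_le hp.2, diff.eq_1 𝓔 u p]
  · linarith [neg_le_of_abs_le hp.2, le_of_abs_le hp.1, diff.eq_1 𝓔 u p]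

theorem jump_cutFun_le (hD : 𝓔.IsDirichletForm) (hR : 𝓔.IsRegular)
    (hμ : ∀ N : Set E, 𝓔.IsPolar N → μ N = 0) (n : ℕ) {u v : Lp ℝ 2 m} (hu : u ∈ 𝓔.dom)
    (hv : v ∈ 𝓔.dom) (h : ∀ᵐ x ∂m, v x = cutFun n (u x)) : 𝓔.jump μ v ≤ 𝓔.jump μ u := by
  refine lintegral_mono_ae ?_
  filter_upwards [ae_prod_of_ae (qcVersion_cutFun hD hR hμ n hu hv h)] with p hp
  rw [diff, hp.1, hp.2]
  exact ENNReal.ofReal_le_ofReal (sq_cutFun_sub_le _ _ _)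

/-- The bound does not involve `u`; here the finiteness of `μ` enters. -/
theorem jump_cut_le (hD : 𝓔.IsDirichletForm) (hR : 𝓔.IsRegular)
    (hμ : ∀ N : Set E, 𝓔.IsPolar N → μ N = 0) (n : ℕ) {u : Lp ℝ 2 m} (hu : u ∈ 𝓔.dom) :
    𝓔.jump μ (cut n u) ≤ ENNReal.ofReal ((2 * n) ^ 2) * (μ.prod μ) Set.univ := by
  refine jump_le_of_ae_le ?_
  filter_upwards [qcVersion_cutFun hD hR hμ n hu (hD.cut_mem n hu).1 (coeFn_cut n u)] with x hx
  rw [hx, abs_of_nonneg (cutFun_nonneg _ _)]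
  exact cutFun_le _ _

theorem cut_mem_snap (hD : 𝓔.IsDirichletForm) (hR : 𝓔.IsRegular)
    (hμ : ∀ N : Set E, 𝓔.IsPolar N → μ N = 0) (n : ℕ) {u : Lp ℝ 2 m} (hu : u ∈ 𝓔.dom) :
    cut n u ∈ (𝓔.snap μ).dom :=
  ⟨(hD.cut_mem n hu).1, (jump_cut_le hD hR hμ n hu).trans_lt
    (ENNReal.mul_lt_top ENNReal.ofReal_lt_top (measure_lt_top _ _))⟩

/-- A continuous function is its own quasi-continuous version, and bounded functions have finite
jump energy. -/
theorem mem_snap_of_cc (hD : 𝓔.IsDirichletForm) (hR : 𝓔.IsRegular)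
    (hμ : ∀ N : Set E, 𝓔.IsPolar N → μ N = 0) {v : Lp ℝ 2 m} (hv : v ∈ 𝓔.dom) {g : E → ℝ}
    (hg : Continuous g) (hgc : HasCompactSupport g) (hvg : v =ᵐ[m] g) :
    v ∈ (𝓔.snap μ).dom := by
  obtain ⟨C, hC⟩ := hgc.exists_bound_of_continuous hg
  refine ⟨hv, (jump_le_of_ae_le (C := C) ?_).trans_lt
    (ENNReal.mul_lt_top ENNReal.ofReal_lt_top (measure_lt_top _ _))⟩
  filter_upwards [qcVersion_ae_eq hD hR hμ hv (QC.of_continuous hD hg) hvg] with x hx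
  rw [hx]
  exact hC x

/-- Lower semicontinuity of the jump energy. -/
theorem jump_sub_le_of_tendsto (hD : 𝓔.IsDirichletForm) (hR : 𝓔.IsRegular)
    (hμ : ∀ N : Set E, 𝓔.IsPolar N → μ N = 0) {u : ℕ → Lp ℝ 2 m} {v w : Lp ℝ 2 m}
    (hu : ∀ n, u n ∈ 𝓔.dom) (hv : v ∈ 𝓔.dom) (hw : w ∈ 𝓔.dom)
    (hs : ∀ n, 𝓔.form₁ (u n - v) (u n - v) ≤ ((1 / 4) ^ n) ^ 2) {C : ℝ≥0∞}
    (hC : ∀ᶠ n in atTop, 𝓔.jump μ (w - u n) ≤ C) : 𝓔.jump μ (w - v) ≤ C := by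
  have hae : ∀ᵐ p ∂(μ.prod μ), Tendsto (fun n => ENNReal.ofReal (𝓔.diff (w - u n) p ^ 2)) atTop
      (𝓝 (ENNReal.ofReal (𝓔.diff (w - v) p ^ 2))) := by
    filter_upwards [ae_prod_of_ae (ae_tendsto_qcVersion hD hR hμ hu hv hs),
      ae_all_iff.2 fun n => diff_sub hD hR hμ hw (hu n), diff_sub hD hR hμ hw hv] with p h1 h2 h3
    simp only [h2, h3]
    refine (ENNReal.continuous_ofReal.tendsto _).comp (Tendsto.pow ?_ 2)
    exact tendsto_const_nhds.sub (h1.1.sub h1.2)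
  calc 𝓔.jump μ (w - v)
      = ∫⁻ p, liminf (fun n => ENNReal.ofReal (𝓔.diff (w - u n) p ^ 2)) atTop ∂(μ.prod μ) :=
        lintegral_congr_ae (hae.mono fun p hp => hp.liminf_eq.symm)
    _ ≤ liminf (fun n => 𝓔.jump μ (w - u n)) atTop :=
        lintegral_liminf_le' fun n =>
          ((aestronglyMeasurable_diff hD hR hμ
            (hD.sub_mem hw (hu n))).pow 2).aemeasurable.ennreal_ofReal
    _ ≤ C := liminf_le_of_frequently_le' hC.frequently

theorem snap_complete (hD : 𝓔.IsDirichletForm) (hR : 𝓔.IsRegular) (hμ₀ : μ ≠ 0)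
    (hμ : ∀ N : Set E, 𝓔.IsPolar N → μ N = 0) {u : ℕ → Lp ℝ 2 m}
    (hu : ∀ n, u n ∈ (𝓔.snap μ).dom)
    (hc : ∀ ε > 0, ∃ N, ∀ i ≥ N, ∀ j ≥ N, (𝓔.snap μ).form₁ (u i - u j) (u i - u j) < ε) :
    ∃ v ∈ (𝓔.snap μ).dom,
      Tendsto (fun n => (𝓔.snap μ).form₁ (u n - v) (u n - v)) atTop (𝓝 0) := by
  have hsub : ∀ i j, u i - u j ∈ (𝓔.snap μ).dom := fun i j => snap_sub_mem hD hR hμ (hu i) (hu j)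
  obtain ⟨v, hv, hlim⟩ := hD.complete u (fun n => (hu n).1) fun ε hε => by
    obtain ⟨N, hN⟩ := hc ε hε
    exact ⟨N, fun i hi j hj => (form₁_le_snap_form₁ hD hR hμ (hsub i j).1).trans_lt (hN i hi j hj)⟩
  -- The `ℰ₁`-limit `v` is the candidate. Along this fast subsequence the versions converge
  -- `μ`-a.e., so Fatou with `u i` fixed bounds the jump energy of `u i - v`.
  obtain ⟨φ, hφ, hφs⟩ := extraction_forall_of_eventually
    (P := fun n k => 𝓔.form₁ (u k - v) (u k - v) ≤ ((1 / 4) ^ n) ^ 2) fun n =>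
      (hlim.eventually (gt_mem_nhds (by positivity))).mono fun k hk => hk.le
  have hμpos : 0 < 2 * μ.real Set.univ := by
    have : NeZero μ := ⟨hμ₀⟩
    have := measureReal_univ_pos (μ := μ)
    positivity
  have hsmall : ∀ ε > 0, ∃ N, ∀ i ≥ N, 𝓔.jump μ (u i - v) ≤ ENNReal.ofReal ε := by
    intro ε hε
    obtain ⟨N, hN⟩ := hc (ε / (2 * μ.real Set.univ)) (by positivity)
    refine ⟨N, fun i hi => jump_sub_le_of_tendsto hD hR hμ (fun n => (hu (φ n)).1) hv (hu i).1
      hφs ?_⟩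
    filter_upwards [hφ.tendsto_atTop.eventually_ge_atTop N] with n hn
    have h1 := hN i hi (φ n) hn
    rw [snap_form₁_self hD hR hμ (hsub _ _).1, one_div, ← div_eq_inv_mul] at h1
    have h2 := hD.form₁_nonneg (hsub i (φ n)).1
    have h3 : (𝓔.jump μ (u i - u (φ n))).toReal / (2 * μ.real Set.univ)
        < ε / (2 * μ.real Set.univ) := by linarith
    rw [div_lt_div_iff_of_pos_right hμpos] at h3
    exact (ENNReal.le_ofReal_iff_toReal_le (hsub i (φ n)).2.ne hε.le).2 h3.le
  have hvs : v ∈ (𝓔.snap μ).dom := by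
    obtain ⟨N, hN⟩ := hsmall 1 one_pos
    have h1 : u N - v ∈ (𝓔.snap μ).dom :=
      ⟨hD.sub_mem (hu N).1 hv, (hN N le_rfl).trans_lt ENNReal.ofReal_lt_top⟩
    have h2 := snap_sub_mem hD hR hμ (hu N) h1
    rwa [sub_sub_cancel] at h2
  refine ⟨v, hvs, ?_⟩
  have hj : Tendsto (fun n => (𝓔.jump μ (u n - v)).toReal) atTop (𝓝 0) := by
    rw [Metric.tendsto_atTop]
    intro ε hε
    obtain ⟨N, hN⟩ := hsmall (ε / 2) (by positivity)
    refine ⟨N, fun i hi => ?_⟩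
    rw [Real.dist_0_eq_abs, abs_of_nonneg ENNReal.toReal_nonneg]
    have := ENNReal.toReal_le_of_le_ofReal (by positivity) (hN i hi)
    linarith
  have h := hlim.add (hj.const_mul (1 / (2 * μ.real Set.univ)))
  rw [mul_zero, add_zero] at h
  exact h.congr fun n => (snap_form₁_self hD hR hμ (hD.sub_mem (hu n).1 hv)).symm

/-- The form obtained by adding the jump term is a Dirichlet form. -/
theorem snap_isDirichletForm (hD : 𝓔.IsDirichletForm) (hR : 𝓔.IsRegular) (hμ₀ : μ ≠ 0)
    (hμ : ∀ N : Set E, 𝓔.IsPolar N → μ N = 0) : (𝓔.snap μ).IsDirichletForm where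
  zero_mem := mem_snap_of_cc hD hR hμ hD.zero_mem continuous_zero HasCompactSupport.zero
    (Lp.coeFn_zero ℝ 2 m)
  add_mem _ hu _ hv := snap_add_mem hD hR hμ hu hv
  smul_mem c _ hu := snap_smul_mem hD hR hμ c hu
  dense := by
    refine dense_closure.1 (hD.dense.mono fun u hu => Metric.mem_closure_iff.2 fun ε hε => ?_)
    obtain ⟨v, hv, ⟨g, hg, hgc, hvg⟩, hlt⟩ := hR.dense_dom u hu (ε ^ 2) (by positivity)
    refine ⟨v, mem_snap_of_cc hD hR hμ hv hg hgc hvg, ?_⟩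
    rw [dist_eq_norm]
    exact lt_of_pow_lt_pow_left₀ 2 hε.le ((hD.norm_sq_le_form₁ (hD.sub_mem hu hv)).trans_lt hlt)
  add_left u hu v hv w hw := by
    have hw' := memLp_diff hD hR hμ hw
    have : ∫ p, 𝓔.diff (u + v) p * 𝓔.diff w p ∂(μ.prod μ) =
        ∫ p, 𝓔.diff u p * 𝓔.diff w p ∂(μ.prod μ) + ∫ p, 𝓔.diff v p * 𝓔.diff w p ∂(μ.prod μ) := by
      refine Eq.trans (integral_congr_ae ?_)
        (integral_add ((memLp_diff hD hR hμ hu).integrable_mul hw')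
          ((memLp_diff hD hR hμ hv).integrable_mul hw'))
      filter_upwards [diff_add hD hR hμ hu.1 hv.1] with p hp
      simp only [hp]
      ring
    rw [snap_form, snap_form, snap_form, this, hD.add_left _ hu.1 _ hv.1 _ hw.1]
    ring
  smul_left c u hu v hv := by
    have : ∫ p, 𝓔.diff (c • u) p * 𝓔.diff v p ∂(μ.prod μ) =
        c * ∫ p, 𝓔.diff u p * 𝓔.diff v p ∂(μ.prod μ) := by
      rw [← integral_const_mul]
      refine integral_congr_ae ?_
      filter_upwards [diff_smul hD hR hμ c hu.1] with p hp
      simp only [hp]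
      ring
    rw [snap_form, snap_form, this, hD.smul_left _ _ hu.1 _ hv.1]
    ring
  symm u hu v hv := by
    rw [snap_form, snap_form, hD.symm _ hu.1 _ hv.1]
    simp only [mul_comm (𝓔.diff u _)]
  nonneg u hu := by
    rw [snap_form_self hD hR hμ hu.1]
    have := hD.nonneg u hu.1
    positivity
  complete _ hu hc := snap_complete hD hR hμ₀ hμ hu hc
  markov u hu := by
    obtain ⟨v, hv, hvu, hle⟩ := hD.markov u hu.1
    have hj : 𝓔.jump μ v ≤ 𝓔.jump μ u := by
      refine jump_cutFun_le hD hR hμ 1 hu.1 hv ?_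
      filter_upwards [hvu] with x hx
      rw [hx, cutFun, Nat.cast_one]
    refine ⟨v, ⟨hv, hj.trans_lt hu.2⟩, hvu, ?_⟩
    rw [snap_form_self hD hR hμ hu.1, snap_form_self hD hR hμ hv]
    have := ENNReal.toReal_mono (mem_snap_dom.1 hu).2.ne hj
    gcongr

/-! ### Density in `𝓕ˢ`: regularity and comparison of nests. -/

/-- A dense subspace of the domain of `ℰ` which is stable under truncation is dense in the domain
of `ℰˢ`. -/
theorem mem_cl_snap (hD : 𝓔.IsDirichletForm) (hR : 𝓔.IsRegular)
    (hμ : ∀ N : Set E, 𝓔.IsPolar N → μ N = 0) (hS : (𝓔.snap μ).IsDirichletForm)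
    {V : Submodule ℝ (Lp ℝ 2 m)} (hcut : ∀ v ∈ V, ∀ n, cut n v ∈ V)
    (hV : ∀ u ∈ 𝓔.dom, u ∈ hD.cl V) {u : Lp ℝ 2 m} (hu : u ∈ (𝓔.snap μ).dom) : u ∈ hS.cl V := by
  refine hS.mem_cl_of_cut (fun u hu n => ?_) hu
  -- Convergence of jump energies is not needed: the truncated `w k` converge in `L²` and their
  -- `ℰˢ₁`-energies are bounded, which is enough for weak compactness.
  obtain ⟨w, hwV, hw, hwC, hwu⟩ := hD.exists_seq_of_mem_cl (hV u hu.1)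
  have hmem := fun k => cut_mem_snap hD hR hμ n (hw k)
  refine (hS.mem_cl_of_tendsto (w := fun k => cut n (w k))
    (C := (2 * 𝓔.form₁ u u + 2) + 1 / (2 * μ.real Set.univ) *
      (ENNReal.ofReal ((2 * n) ^ 2) * (μ.prod μ) Set.univ).toReal)
    (fun k => hS.mem_cl_of_mem (hmem k) (hcut _ (hwV k) n)) (fun k => ?_)
    ((continuous_cut n).continuousAt.tendsto.comp hwu)).1
  rw [snap_form₁_self hD hR hμ (hmem k).1]
  have h1 := (hD.cut_mem n (hw k)).2.trans (hwC k)
  have h2 := ENNReal.toReal_mono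
    (ENNReal.mul_lt_top ENNReal.ofReal_lt_top (measure_lt_top _ _)).ne
    (jump_cut_le hD hR hμ n (hw k))
  gcongr

/-- Truncation fixes `0` and is continuous, so it preserves `C_c(E)`. The uniform density is
inherited because `𝓕 ∩ C_c(E)` already lies in `𝓕ˢ`. -/
theorem snap_isRegular (hD : 𝓔.IsDirichletForm) (hR : 𝓔.IsRegular) (hμ₀ : μ ≠ 0)
    (hμ : ∀ N : Set E, 𝓔.IsPolar N → μ N = 0) : (𝓔.snap μ).IsRegular where
  dense_dom u hu ε hε := by
    have hS := snap_isDirichletForm hD hR hμ₀ hμ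
    have hcl : u ∈ hS.cl (ccSubmodule hD) := by
      refine mem_cl_snap hD hR hμ hS ?_ (fun u hu => mem_cl_ccSubmodule hD hR hu) hu
      rintro v ⟨hv, g, hg, hgc, hvg⟩ n
      refine ⟨(hD.cut_mem n hv).1, fun x => cutFun n (g x),
        (lipschitzWith_cutFun n).continuous.comp hg, hgc.comp_left (cutFun_zero_right n), ?_⟩
      filter_upwards [coeFn_cut n v, hvg] with x h1 h2
      rw [h1, h2]
    obtain ⟨v, ⟨-, hg⟩, hv, hlt⟩ := (hS.mem_cl.1 hcl).2 ε hε
    exact ⟨v, hv, hg, hlt⟩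
  dense_Cc f hf hfc ε hε := by
    obtain ⟨g, hg, hgc, ⟨v, hv, hvg⟩, hfg⟩ := hR.dense_Cc f hf hfc ε hε
    exact ⟨g, hg, hgc, ⟨v, mem_snap_of_cc hD hR hμ hv hg hgc hvg, hvg⟩, hfg⟩

/-- From `ℰˢ` to `ℰ` it suffices to approximate truncations, which lie in `𝓕ˢ`, and there `ℰ₁ ≤
ℰˢ₁`. Conversely, truncation preserves vanishing off `F k`, so `mem_cl_snap` applies. -/
theorem snap_isNest_iff (hD : 𝓔.IsDirichletForm) (hR : 𝓔.IsRegular) (hμ₀ : μ ≠ 0)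
    (hμ : ∀ N : Set E, 𝓔.IsPolar N → μ N = 0) (F : ℕ → Set E) :
    (𝓔.snap μ).IsNest F ↔ 𝓔.IsNest F := by
  have hS := snap_isDirichletForm hD hR hμ₀ hμ
  constructor
  · intro h
    rw [isNest_iff hD h.mono h.closed]
    intro u hu
    refine hD.mem_cl_of_cut (fun u hu n => hD.mem_cl.2 ⟨(hD.cut_mem n hu).1, fun ε hε => ?_⟩) hu
    obtain ⟨k, v, hv, hv0, hlt⟩ := h.dense _ (cut_mem_snap hD hR hμ n hu) ε hε
    exact ⟨v, ⟨hv.1, k, hv0⟩, hv.1,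
      (form₁_le_snap_form₁ hD hR hμ (hD.sub_mem (hD.cut_mem n hu).1 hv.1)).trans_lt hlt⟩
  · intro h
    refine ⟨h.mono, h.closed, fun u hu ε hε => ?_⟩
    have hcl : u ∈ hS.cl (vanishing hD h.mono) := by
      refine mem_cl_snap hD hR hμ hS ?_ ((isNest_iff hD h.mono h.closed).1 h) hu
      rintro v ⟨hv, k, hv0⟩ n
      refine ⟨(hD.cut_mem n hv).1, k, ?_⟩
      filter_upwards [coeFn_cut n v, hv0] with x h1 h2 hx
      rw [h1, h2 hx, cutFun_zero_right]
    obtain ⟨v, ⟨-, k, hv0⟩, hv, hlt⟩ := (hS.mem_cl.1 hcl).2 ε hε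
    exact ⟨k, v, hv, hv0, hlt⟩

end

end SnappingOut.FormPair

theorem corollary3p6 {E : Type*} [MetricSpace E] [LocallyCompactSpace E]
    [TopologicalSpace.SeparableSpace E] [MeasurableSpace E] [BorelSpace E]
    (m : Measure E) [IsFiniteMeasureOnCompacts m] [m.IsOpenPosMeasure]
    (𝓔 : SnappingOut.FormPair m) (hD : 𝓔.IsDirichletForm) (hR : 𝓔.IsRegular)
    (μ : Measure E) [IsFiniteMeasure μ] (hμ₀ : μ ≠ 0)
    (hμ : ∀ N : Set E, 𝓔.IsPolar N → μ N = 0) :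
    (𝓔.snap μ).IsDirichletForm ∧ (𝓔.snap μ).IsRegular ∧
    (∀ F : ℕ → Set E, (𝓔.snap μ).IsNest F ↔ 𝓔.IsNest F) ∧
    (∀ N : Set E, (𝓔.snap μ).IsPolar N ↔ 𝓔.IsPolar N) ∧
    (∀ f : E → EReal, (𝓔.snap μ).IsQuasiContinuous f ↔ 𝓔.IsQuasiContinuous f) := by
  have hN := SnappingOut.FormPair.snap_isNest_iff hD hR hμ₀ hμ
  refine ⟨SnappingOut.FormPair.snap_isDirichletForm hD hR hμ₀ hμ,
    SnappingOut.FormPair.snap_isRegular hD hR hμ₀ hμ, hN, fun N => ?_, fun f => ?_⟩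
  · simp only [SnappingOut.FormPair.IsPolar, hN]
  · simp only [SnappingOut.FormPair.IsQuasiContinuous, hN]
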